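/- **Key renewal theorem for cluster processes.** Let $W'_i=(L'_i,(T'_{ij})_{j\ge 1},X'_i)$, $i\ge 0$, be independent random elements of $\mathbb N_0\times\mathbb R^{\mathbb N}\times\mathbb R_+$ such that $(W'_i)_{i\ge 1}$ are identically distributed (the law of $W'_0$ is arbitrary, and the components of each $W'_i$ may be dependent). Suppose that $X'_1$ has a finite mean $\mu=\mathbb E X'_1>0$ and a nonarithmetic distribution, i.e. there is no $h>0$ with $\mathbb P(X'_1\in h\mathbb Z)=1$. Put $T'_i=\sum_{k=0}^i X'_k$, $R'_i=\max_{1\le j\le L'_i}|T'_{ij}|$ (equal to $0$ if $L'_i=0$), and let $$\xi'=\sum_{i\ge 0}\sum_{j=1}^{L'_i}\delta_{T'_i+T'_{ij}}$$ be the associated renewal cluster point process on $\mathbb R$, assumed to be almost surely finite on all bounded Borel sets. Assume that $L'_0$, $L'_1$, $L'_1X'_1$ and $L'_1R'_1$ have finite mean. Then the renewal function $U_{\xi'}(t)=\mathbb E\big[\sum_{i\ge 0}\sum_{j=1}^{L'_i}\mathbf 1_{\{T'_i+T'_{ij}\le t\}}\big]$ is finite for all $t\in\mathbb R$. Denote also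 by $U_{\xi'}$ the renewal measure, i.e. the mean measure $U_{\xi'}(B)=\mathbb E\,\xi'(B)$, which is the unique measure on $\mathbb R$ with $U_{\xi'}((-\infty,t])=U_{\xi'}(t)$ for all $t$. Let $g:\mathbb R_+\to\mathbb R_+$ be directly Riemann integrable, i.e. with $\overline\sigma(h)=h\sum_{k\ge 1}\sup_{(k-1)h\le y<kh}g(y)$ and $\underline\sigma(h)=h\sum_{k\ge 1}\inf_{(k-1)h\le y<kh}g(y)$ one has $\overline\sigma(h)<\infty$ for all $h>0$ and $\overline\sigma(h)-\underline\sigma(h)\to 0$ as $h\downarrow 0$. Then $\int_0^\infty g(y)\,\mathrm dy<\infty$, the integrals $\int_0^t g(t-y)\,\mathrm dU_{\xi'}(y)$ are finite for all $t$, and $$\lim_{t\to\infty}\int_0^t g(t-y)\,\mathrm dU_{\xi'}(y)=\frac{\mathbb E L'_1}{\mu}\int_0^\infty g(y)\,\mathrm dy .$$ This holds whether $\int_0^t$ is taken over $[0,t]$ or over $(0,t]$. (If $g$ is not Borel measurable, the integral with respect to $U_{\xi'}$ is understood as a lower integral.) -/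

import Mathlib

open MeasureTheory ProbabilityTheory Filter Topology Set
open scoped NNReal ENNReal

namespace RenewalCluster

variable {Ω : Type*}

/-- The `i`-th mark `W'_i = (L'_i, (T'_{ij})_j, X'_i)`, an element of `ℕ × ℝ^ℕ × ℝ₊`:
the cluster size, the positions of the cluster points relative to the parent, and the increment of
the parent process. The points of a cluster of size `n` are indexed by `j = 0, …, n - 1`. -/
def mark (L : ℕ → Ω → ℕ) (τ : ℕ → ℕ → Ω → ℝ) (X : ℕ → Ω → ℝ≥0) (i : ℕ) (ω : Ω) :
    ℕ × (ℕ → ℝ) × ℝ≥0 :=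
  (L i ω, fun j => τ i j ω, X i ω)

/-- The parent points `T'_i = X'_0 + ⋯ + X'_i`. -/
def arrival (X : ℕ → Ω → ℝ≥0) (i : ℕ) (ω : Ω) : ℝ :=
  ∑ k ∈ Finset.range (i + 1), (X k ω : ℝ)

/-- The cluster radius `R'_i`, the largest of the `|T'_{ij}|` (it is `0` for an empty cluster). -/
def radius (L : ℕ → Ω → ℕ) (τ : ℕ → ℕ → Ω → ℝ) (i : ℕ) (ω : Ω) : ℝ≥0 :=
  (Finset.range (L i ω)).sup fun j => ‖τ i j ω‖₊

/-- The cluster point process `ξ' = ∑_i ∑_{j ≤ L'_i} δ_{T'_i + T'_{ij}}`. -/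
noncomputable def clusterProcess (L : ℕ → Ω → ℕ) (τ : ℕ → ℕ → Ω → ℝ) (X : ℕ → Ω → ℝ≥0)
    (ω : Ω) : Measure ℝ :=
  Measure.sum fun i => ∑ j ∈ Finset.range (L i ω), Measure.dirac (arrival X i ω + τ i j ω)

/-- The renewal function `U(t) = E[∑_i ∑_{j ≤ L'_i} 1{T'_i + T'_{ij} ≤ t}]`. -/
noncomputable def renewalFunction [MeasurableSpace Ω] (P : Measure Ω)
    (L : ℕ → Ω → ℕ) (τ : ℕ → ℕ → Ω → ℝ) (X : ℕ → Ω → ℝ≥0) (t : ℝ) : ℝ≥0∞ :=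
  ∫⁻ ω, ∑' i, ∑ j ∈ Finset.range (L i ω),
    (Iic t).indicator (fun _ => (1 : ℝ≥0∞)) (arrival X i ω + τ i j ω) ∂P

/-- The renewal measure `U(B) = E[ξ'(B)]`. It satisfies `U((-∞, t]) = U(t)` for all `t`
(`renewalMeasure_Iic`), and is the only such measure if the renewal function is finite
(`eq_renewalMeasure`). -/
noncomputable def renewalMeasure [MeasurableSpace Ω] (P : Measure Ω)
    (L : ℕ → Ω → ℕ) (τ : ℕ → ℕ → Ω → ℝ) (X : ℕ → Ω → ℝ≥0) : Measure ℝ :=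
  P.bind (clusterProcess L τ X)

/-- `ξ'` is a renewal cluster point process: the marks are independent, those with index `i ≥ 1`
are identically distributed (the mark with index `0` may have any law), the increments `X'_i`,
`i ≥ 1`, are nonarithmetic with a finite positive mean, and almost surely `ξ'` is finite on bounded
sets. Dependence between the components of a mark is allowed. -/
structure IsRenewalClusterProcess [MeasurableSpace Ω] (P : Measure Ω)
    (L : ℕ → Ω → ℕ) (τ : ℕ → ℕ → Ω → ℝ) (X : ℕ → Ω → ℝ≥0) : Prop where
  measurable_size : ∀ i, Measurable (L i)
  measurable_pos : ∀ i j, Measurable (τ i j)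
  measurable_incr : ∀ i, Measurable (X i)
  indep : iIndepFun (mark L τ X) P
  identDistrib : ∀ i, 1 ≤ i → IdentDistrib (mark L τ X i) (mark L τ X 1) P P
  integrable_incr : Integrable (fun ω => (X 1 ω : ℝ)) P
  mean_pos : 0 < ∫ ω, (X 1 ω : ℝ) ∂P
  nonarithmetic : ∀ h : ℝ, 0 < h → ¬ ∀ᵐ ω ∂P, ∃ k : ℤ, (X 1 ω : ℝ) = k * h
  locallyFinite : ∀ᵐ ω ∂P, ∀ B : Set ℝ, MeasurableSet B → Bornology.IsBounded B →
    clusterProcess L τ X ω B < ∞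

/-- The random variables `L'_0`, `L'_1`, `L'_1 X'_1` and `L'_1 R'_1` have finite mean. -/
structure FiniteMoments [MeasurableSpace Ω] (P : Measure Ω)
    (L : ℕ → Ω → ℕ) (τ : ℕ → ℕ → Ω → ℝ) (X : ℕ → Ω → ℝ≥0) : Prop where
  size_zero : Integrable (fun ω => (L 0 ω : ℝ)) P
  size_one : Integrable (fun ω => (L 1 ω : ℝ)) P
  size_incr : Integrable (fun ω => (L 1 ω : ℝ) * (X 1 ω : ℝ)) P
  size_radius : Integrable (fun ω => (L 1 ω : ℝ) * (radius L τ 1 ω : ℝ)) P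

/-- The upper sum `h ∑_k sup_{kh ≤ y < (k+1)h} g(y)`. -/
noncomputable def upperSum (g : ℝ≥0 → ℝ≥0) (h : ℝ≥0) : ℝ≥0∞ :=
  h * ∑' k : ℕ, ⨆ y ∈ Ico (k * h) ((k + 1) * h), (g y : ℝ≥0∞)

/-- The lower sum `h ∑_k inf_{kh ≤ y < (k+1)h} g(y)`. -/
noncomputable def lowerSum (g : ℝ≥0 → ℝ≥0) (h : ℝ≥0) : ℝ≥0∞ :=
  h * ∑' k : ℕ, ⨅ y ∈ Ico (k * h) ((k + 1) * h), (g y : ℝ≥0∞)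

/-- Direct Riemann integrability on `[0, ∞)`: the upper sums over all partitions of mesh `h` are
finite, and the difference of the upper and lower sums vanishes as `h → 0`. -/
structure DirectlyRiemannIntegrable (g : ℝ≥0 → ℝ≥0) : Prop where
  upperSum_lt_top : ∀ h : ℝ≥0, 0 < h → upperSum g h < ∞
  tendsto_sub : Tendsto (fun h => upperSum g h - lowerSum g h) (𝓝[>] 0) (𝓝 0)

section Facts

variable {L : ℕ → Ω → ℕ} {τ : ℕ → ℕ → Ω → ℝ} {X : ℕ → Ω → ℝ≥0}

theorem clusterProcess_apply (ω : Ω) {B : Set ℝ} (hB : MeasurableSet B) :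
    clusterProcess L τ X ω B = ∑' i, ∑ j ∈ Finset.range (L i ω),
      B.indicator (fun _ => (1 : ℝ≥0∞)) (arrival X i ω + τ i j ω) := by
  simp only [clusterProcess, Measure.sum_apply _ hB, Measure.coe_finsetSum, Finset.sum_apply,
    Measure.dirac_apply' _ hB]
  rfl

variable [MeasurableSpace Ω] {P : Measure Ω}

theorem measurable_clusterProcess (hL : ∀ i, Measurable (L i))
    (hτ : ∀ i j, Measurable (τ i j)) (hX : ∀ i, Measurable (X i)) :
    Measurable (clusterProcess L τ X) := by
  refine Measure.measurable_of_measurable_coe _ fun B hB => ?_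
  have h1 : Measurable fun x : ℝ => B.indicator (fun _ => (1 : ℝ≥0∞)) x :=
    measurable_const.indicator hB
  have hT : ∀ i, Measurable (arrival X i) := fun i =>
    Finset.measurable_fun_sum _ fun k _ => (hX k).coe_nnreal_real
  have h2 : ∀ i n, Measurable fun ω => ∑ j ∈ Finset.range n,
      B.indicator (fun _ => (1 : ℝ≥0∞)) (arrival X i ω + τ i j ω) := fun i n =>
    Finset.measurable_fun_sum _ fun j _ => h1.comp ((hT i).add (hτ i j))
  have h3 : ∀ i, Measurable fun ω => ∑ j ∈ Finset.range (L i ω),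
      B.indicator (fun _ => (1 : ℝ≥0∞)) (arrival X i ω + τ i j ω) := by
    intro i
    have h : Measurable fun p : ℕ × Ω => ∑ j ∈ Finset.range p.1,
        B.indicator (fun _ => (1 : ℝ≥0∞)) (arrival X i p.2 + τ i j p.2) :=
      measurable_from_prod_countable_right (h2 i)
    exact h.comp (g := fun p : ℕ × Ω => ∑ j ∈ Finset.range p.1,
        B.indicator (fun _ => (1 : ℝ≥0∞)) (arrival X i p.2 + τ i j p.2))
      (f := fun ω => (L i ω, ω)) ((hL i).prodMk measurable_id)
  have h4 : Measurable fun ω => ∑' i, ∑ j ∈ Finset.range (L i ω),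
      B.indicator (fun _ => (1 : ℝ≥0∞)) (arrival X i ω + τ i j ω) := Measurable.tsum h3
  simpa only [clusterProcess_apply _ hB] using h4

theorem renewalMeasure_Iic (hL : ∀ i, Measurable (L i)) (hτ : ∀ i j, Measurable (τ i j))
    (hX : ∀ i, Measurable (X i)) (t : ℝ) :
    renewalMeasure P L τ X (Iic t) = renewalFunction P L τ X t := by
  rw [renewalMeasure, Measure.bind_apply measurableSet_Iic
    (measurable_clusterProcess hL hτ hX).aemeasurable]
  simp only [clusterProcess_apply _ measurableSet_Iic, renewalFunction]

theorem eq_renewalMeasure (hL : ∀ i, Measurable (L i)) (hτ : ∀ i j, Measurable (τ i j))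
    (hX : ∀ i, Measurable (X i)) (hU : ∀ t, renewalFunction P L τ X t < ∞) (M : Measure ℝ)
    (hM : ∀ t, M (Iic t) = renewalFunction P L τ X t) : M = renewalMeasure P L τ X := by
  have key : ∀ N : Measure ℝ, (∀ t, N (Iic t) = renewalFunction P L τ X t) → ∀ a b, a < b →
      N (Ioc a b) = renewalFunction P L τ X b - renewalFunction P L τ X a := by
    intro N hN a b hab
    rw [show Ioc a b = Iic b \ Iic a by ext x; simp [and_comm], measure_sdiff (Iic_subset_Iic.2 hab.le)
      measurableSet_Iic.nullMeasurableSet (by rw [hN]; exact (hU a).ne), hN, hN]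
  have hR := renewalMeasure_Iic (P := P) hL hτ hX
  refine Measure.ext_of_Ioc' M _ (fun a b hab => ?_) fun a b hab => ?_
  · rw [key M hM a b hab]
    exact (tsub_le_self.trans_lt (hU b)).ne
  · rw [key M hM a b hab, key _ hR a b hab]

end Facts

end RenewalCluster

/-! Seen from the preceding parent `T'_{i-1}`, the cluster of index `i ≥ 1` has its points at `X'_i
+ T'_{ij}`. These depend only on the mark `W'_i`, which is independent of `T'_{i-1}`, so dependence
inside a mark is harmless. Taking means gives `U = N₀ + V ∗ N`: here `V` is the renewal measure of
the parent points, `N` the mean measure of the points `X'_1 + T'_{1j}`, of total mass `E L'_1`, and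
`N₀` the same for the mark of index `0` (`renewalMeasure_eq`). Since `N₀` and `N` are finite,
everything reduces to Blackwell's theorem for `V`. The moments of `L'_1 X'_1` and `L'_1 R'_1` enter
only to make `U(t)` finite, through the linear growth of `V(-∞, t]`.

Blackwell's theorem is proved analytically. For `z` continuous with compact support, `u = z ∗ V` is
bounded, uniformly continuous and solves `u = r + u ∗ F` with `r → 0`. A maximum-principle argument
shows that `u(t) - u(t - a) → 0` for each `a` in the support of `F`. The set of such `a` is a closed
subgroup, hence all of `ℝ` when `F` is nonarithmetic (`tendsto_sub_of_nonarithmetic`). The limit is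
identified by the survival function `H(y) = F(y, ∞)`, which has integral `μ` and satisfies `(H ∗
V)(t) = D(-∞, t]`, with `D` the delay law (`lintegral_survival_eq`). On the one hand `∫ H(y) u(t -
y) dy → ∫ z`; on the other hand, by dominated convergence, this integral differs from `μ u(t)` by
`o(1)`. So `u → μ⁻¹ ∫ z`.

Finally, vague convergence of the shifted measures together with a uniform bound on intervals of
fixed length passes from `z` to intervals, then to step functions, and by squeezing between lower
and upper sums to directly Riemann integrable `g` (`tendsto_lintegral_of_vague`). -/

namespace RenewalCluster

/-! ### From vague convergence to directly Riemann integrable functions. -/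

section DirectRiemann

/-- Measures that are uniformly bounded on intervals of each given length. -/
def UniformlyLocallyFinite (M : Measure ℝ) : Prop :=
  ∀ h : ℝ, ∃ C : ℝ≥0∞, C ≠ ∞ ∧ ∀ a, M (Ioc a (a + h)) ≤ C

theorem tsum_mul_indicator_Ico (s : ℕ → ℝ≥0∞) {h x : ℝ} (hh : 0 < h) (hx : 0 ≤ x) :
    ∑' k : ℕ, (Ico (k * h) ((k + 1) * h)).indicator (fun _ => s k) x = s ⌊x / h⌋₊ := by
  have hmem : ∀ k : ℕ, x ∈ Ico (k * h) ((k + 1) * h) ↔ ⌊x / h⌋₊ = k := by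
    intro k
    rw [Nat.floor_eq_iff (by positivity), le_div_iff₀ hh, div_lt_iff₀ hh, mem_Ico]
  rw [tsum_eq_single ⌊x / h⌋₊]
  · rw [indicator_of_mem ((hmem _).2 rfl)]
  · intro k hk
    rw [indicator_of_notMem]
    rw [hmem]
    exact fun h' => hk h'.symm

theorem toNNReal_mem_Ico_floor {h : ℝ≥0} {x : ℝ} (hh : 0 < h) (hx : 0 ≤ x) :
    x.toNNReal ∈ Ico ((⌊x / h⌋₊ : ℝ≥0) * h) (((⌊x / h⌋₊ : ℝ≥0) + 1) * h) := by
  have hh' : (0 : ℝ) < h := hh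
  have h1 := Nat.floor_le (show 0 ≤ x / h by positivity)
  have h2 := Nat.lt_floor_add_one (x / h)
  rw [le_div_iff₀ hh'] at h1
  rw [div_lt_iff₀ hh'] at h2
  constructor
  · rw [← NNReal.coe_le_coe]
    simpa [Real.coe_toNNReal _ hx] using h1
  · rw [← NNReal.coe_lt_coe]
    simpa [Real.coe_toNNReal _ hx] using h2

/-- Comparison with a step function needs only monotonicity of the lower integral, so `g` need not
be measurable. The map `φ` serves twice: the identity for Lebesgue measure, and `y ↦ t - y` for the
renewal measure. -/
theorem lintegral_le_tsum_iSup (g : ℝ≥0 → ℝ≥0) {h : ℝ≥0} (hh : 0 < h) (M : Measure ℝ)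
    {φ : ℝ → ℝ} (hφ : Measurable φ) {A : Set ℝ} (hA : MeasurableSet A) (hA0 : ∀ y ∈ A, 0 ≤ φ y) :
    ∫⁻ y in A, (g (φ y).toNNReal : ℝ≥0∞) ∂M ≤
      ∑' k : ℕ, (⨆ y ∈ Ico (k * h) ((k + 1) * h), (g y : ℝ≥0∞)) *
        M (φ ⁻¹' Ico (k * h) ((k + 1) * h)) := by
  set s : ℕ → ℝ≥0∞ := fun k => ⨆ y ∈ Ico (k * h) ((k + 1) * h), (g y : ℝ≥0∞) with hs
  calc ∫⁻ y in A, (g (φ y).toNNReal : ℝ≥0∞) ∂M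
      ≤ ∫⁻ y in A, ∑' k : ℕ, (φ ⁻¹' Ico (k * h) ((k + 1) * h)).indicator (fun _ => s k) y ∂M := by
        refine setLIntegral_mono' hA fun y hy => ?_
        have := tsum_mul_indicator_Ico s (h := h) (x := φ y) hh (hA0 y hy)
        simp only [indicator, mem_preimage] at this ⊢
        rw [this]
        exact le_iSup₂ (f := fun y (_ : y ∈ Ico _ _) => (g y : ℝ≥0∞)) _
          (toNNReal_mem_Ico_floor hh (hA0 y hy))
    _ ≤ ∫⁻ y, ∑' k : ℕ, (φ ⁻¹' Ico (k * h) ((k + 1) * h)).indicator (fun _ => s k) y ∂M :=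
        setLIntegral_le_lintegral _ _
    _ = _ := by
        rw [lintegral_tsum fun k =>
          (measurable_const.indicator (hφ measurableSet_Ico)).aemeasurable]
        exact tsum_congr fun k => lintegral_indicator_const (hφ measurableSet_Ico) _

theorem tsum_iInf_le_lintegral (g : ℝ≥0 → ℝ≥0) {h : ℝ≥0} (hh : 0 < h) (M : Measure ℝ)
    {φ : ℝ → ℝ} (hφ : Measurable φ) {A : Set ℝ} (hA : MeasurableSet A) (hA0 : ∀ y ∈ A, 0 ≤ φ y) :
    ∑' k : ℕ, (⨅ y ∈ Ico (k * h) ((k + 1) * h), (g y : ℝ≥0∞)) *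
        M (φ ⁻¹' Ico (k * h) ((k + 1) * h) ∩ A) ≤
      ∫⁻ y in A, (g (φ y).toNNReal : ℝ≥0∞) ∂M := by
  set s : ℕ → ℝ≥0∞ := fun k => ⨅ y ∈ Ico (k * h) ((k + 1) * h), (g y : ℝ≥0∞) with hs
  calc _ = ∫⁻ y in A, ∑' k : ℕ, (φ ⁻¹' Ico (k * h) ((k + 1) * h)).indicator
          (fun _ => s k) y ∂M := by
        rw [lintegral_tsum fun k =>
          (measurable_const.indicator (hφ measurableSet_Ico)).aemeasurable]
        refine tsum_congr fun k => ?_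
        rw [lintegral_indicator_const (hφ measurableSet_Ico),
          Measure.restrict_apply (hφ measurableSet_Ico)]
    _ ≤ _ := by
        refine setLIntegral_mono' hA fun y hy => ?_
        have := tsum_mul_indicator_Ico s (h := h) (x := φ y) hh (hA0 y hy)
        simp only [indicator, mem_preimage] at this ⊢
        rw [this]
        exact iInf₂_le (f := fun y (_ : y ∈ Ico _ _) => (g y : ℝ≥0∞)) _
          (toNNReal_mem_Ico_floor hh (hA0 y hy))

/-- Dominated convergence for the counting measure on `ℕ`. -/
theorem tendsto_tsum_mul_of_dominated {α : Type*} {l : Filter α} [l.IsCountablyGenerated]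
    {s : ℕ → ℝ≥0∞} (hs : ∑' k, s k ≠ ∞) {m : α → ℕ → ℝ≥0∞} {C : ℝ≥0∞} (hC : C ≠ ∞)
    (hm : ∀ t k, m t k ≤ C) {q : ℕ → ℝ≥0∞} (hq : ∀ k, Tendsto (fun t => m t k) l (𝓝 (q k))) :
    Tendsto (fun t => ∑' k, s k * m t k) l (𝓝 (∑' k, s k * q k)) := by
  simp only [← lintegral_count]
  refine tendsto_lintegral_filter_of_dominated_convergence (fun k => s k * C)
    (Eventually.of_forall fun t => measurable_of_countable _)
    (Eventually.of_forall fun t => Eventually.of_forall fun k => by gcongr; exact hm t k) ?_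
    (Eventually.of_forall fun k =>
      ENNReal.Tendsto.const_mul (hq k) (Or.inr (ENNReal.ne_top_of_tsum_ne_top hs k)))
  rw [lintegral_count, ENNReal.tsum_mul_right]
  exact ENNReal.mul_ne_top hs hC

/-- The indicator of the interval is squeezed between thickened indicators of intervals shrunk or
enlarged by `ε`. Lebesgue measure does not charge endpoints, so the resulting error `2ε` disappears
as `ε → 0`. -/
theorem tendsto_measure_Ioc_of_vague {M : Measure ℝ} {c : ℝ≥0∞} (hc : c ≠ ∞)
    (hM : ∀ z : ℝ → ℝ≥0, Continuous z → HasCompactSupport z →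
      Tendsto (fun t : ℝ => ∫⁻ y, (z (t - y) : ℝ≥0∞) ∂M) atTop (𝓝 (c * ∫⁻ x, (z x : ℝ≥0∞))))
    (a b : ℝ) :
    Tendsto (fun t => M (Ioc (t - b) (t - a))) atTop (𝓝 (c * ENNReal.ofReal (b - a))) := by
  have hcs : ∀ (ε : ℝ) (hε : 0 < ε) (p q : ℝ),
      HasCompactSupport (thickenedIndicator hε (Icc p q)) := by
    intro ε hε p q
    refine HasCompactSupport.intro (K := Metric.cthickening ε (Icc p q))
      (Metric.isCompact_of_isClosed_isBounded Metric.isClosed_cthickening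
        (Metric.isBounded_Icc p q).cthickening) fun x hx => ?_
    exact thickenedIndicator_zero hε _ fun h => hx (Metric.thickening_subset_cthickening _ _ h)
  have hlim : ∀ (ε : ℝ) (hε : 0 < ε) (p q : ℝ), _ := fun ε hε p q =>
    hM (thickenedIndicator hε (Icc p q)) (thickenedIndicator hε (Icc p q)).continuous (hcs ε hε p q)
  have hzero : ∀ (ε : ℝ) (hε : 0 < ε) (p q x : ℝ), x ∉ Ioo (p - ε) (q + ε) →
      thickenedIndicator hε (Icc p q) x = 0 := by
    intro ε hε p q x hx
    refine thickenedIndicator_zero hε _ fun h => hx ?_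
    obtain ⟨y, hy, hxy⟩ := Metric.mem_thickening_iff.1 h
    rw [Real.dist_eq, abs_lt] at hxy
    exact ⟨by linarith [hy.1], by linarith [hy.2]⟩
  have hcont : ∀ κ : ℝ, Tendsto (fun ε : ℝ => c * ENNReal.ofReal (b - a + κ * ε)) (𝓝[>] 0)
      (𝓝 (c * ENNReal.ofReal (b - a))) := by
    intro κ
    refine ENNReal.Tendsto.const_mul (ENNReal.tendsto_ofReal ?_) (Or.inr hc)
    have : Continuous fun ε : ℝ => b - a + κ * ε := by fun_prop
    simpa using (this.tendsto 0).mono_left nhdsWithin_le_nhds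
  refine tendsto_of_le_liminf_of_limsup_le ?_ ?_
  · refine le_of_tendsto (hcont (-2)) ?_
    filter_upwards [self_mem_nhdsWithin] with ε (hε : 0 < ε)
    calc c * ENNReal.ofReal (b - a + -2 * ε)
        ≤ c * ∫⁻ x, (thickenedIndicator hε (Icc (a + ε) (b - ε)) x : ℝ≥0∞) := by
          gcongr
          calc ENNReal.ofReal (b - a + -2 * ε) = ∫⁻ x, (Icc (a + ε) (b - ε)).indicator 1 x := by
                rw [lintegral_indicator_one measurableSet_Icc, Real.volume_Icc]
                congr 1
                ring
            _ ≤ _ := by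
                refine lintegral_mono fun x => ?_
                by_cases hx : x ∈ Icc (a + ε) (b - ε)
                · simp [hx, thickenedIndicator_one hε _ hx]
                · simp [hx]
      _ = liminf (fun t : ℝ => ∫⁻ y, (thickenedIndicator hε (Icc (a + ε) (b - ε)) (t - y) : ℝ≥0∞)
            ∂M) atTop := (hlim ε hε _ _).liminf_eq.symm
      _ ≤ _ := by
          refine liminf_le_liminf (Eventually.of_forall fun t => ?_)
          rw [← lintegral_indicator_one measurableSet_Ioc]
          refine lintegral_mono fun y => ?_
          by_cases hy : y ∈ Ioc (t - b) (t - a)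
          · simpa [hy] using thickenedIndicator_le_one hε _ _
          · rw [hzero ε hε]
            · simp
            · exact fun h => hy ⟨by linarith [h.2], by linarith [h.1]⟩
  · refine ge_of_tendsto (hcont 2) ?_
    filter_upwards [self_mem_nhdsWithin] with ε (hε : 0 < ε)
    calc _ ≤ limsup (fun t : ℝ => ∫⁻ y, (thickenedIndicator hε (Icc a b) (t - y) : ℝ≥0∞)
            ∂M) atTop := by
          refine limsup_le_limsup (Eventually.of_forall fun t => ?_)
          dsimp only
          rw [← lintegral_indicator_one measurableSet_Ioc]
          refine lintegral_mono fun y => ?_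
          by_cases hy : y ∈ Ioc (t - b) (t - a)
          · have hy' : t - y ∈ Icc a b := ⟨by linarith [hy.2], by linarith [hy.1]⟩
            simp [hy, thickenedIndicator_one hε _ hy']
          · simp [hy]
      _ = c * ∫⁻ x, (thickenedIndicator hε (Icc a b) x : ℝ≥0∞) := (hlim ε hε _ _).limsup_eq
      _ ≤ c * ENNReal.ofReal (b - a + 2 * ε) := by
          gcongr
          calc _ ≤ ∫⁻ x, (Ioo (a - ε) (b + ε)).indicator 1 x := by
                refine lintegral_mono fun x => ?_
                by_cases hx : x ∈ Ioo (a - ε) (b + ε)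
                · simpa [hx] using thickenedIndicator_le_one hε _ _
                · rw [hzero ε hε _ _ _ hx]
                  simp
            _ = _ := by
                rw [lintegral_indicator_one measurableSet_Ioo, Real.volume_Ioo]
                congr 1
                ring

theorem preimage_const_sub_Ico (t a b : ℝ) :
    (fun y => t - y) ⁻¹' Ico a b = Ioc (t - b) (t - a) := by
  ext y
  simp only [mem_preimage, mem_Ico, mem_Ioc]
  constructor <;> rintro ⟨h1, h2⟩ <;> constructor <;> linarith

theorem upperSum_eq (g : ℝ≥0 → ℝ≥0) (h : ℝ≥0) : upperSum g h =
    ∑' k : ℕ, (⨆ y ∈ Ico (k * h) ((k + 1) * h), (g y : ℝ≥0∞)) * h := by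
  rw [upperSum, ENNReal.tsum_mul_right, mul_comm]

theorem lowerSum_eq (g : ℝ≥0 → ℝ≥0) (h : ℝ≥0) : lowerSum g h =
    ∑' k : ℕ, (⨅ y ∈ Ico (k * h) ((k + 1) * h), (g y : ℝ≥0∞)) * h := by
  rw [lowerSum, ENNReal.tsum_mul_right, mul_comm]

theorem iInf_Ico_le_iSup_Ico (g : ℝ≥0 → ℝ≥0) {h : ℝ≥0} (hh : 0 < h) (k : ℕ) :
    ⨅ y ∈ Ico (k * h) ((k + 1) * h), (g y : ℝ≥0∞) ≤
      ⨆ y ∈ Ico (k * h) ((k + 1) * h), (g y : ℝ≥0∞) := by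
  have hk : (k * h : ℝ≥0) ∈ Ico (k * h) ((k + 1) * h) :=
    ⟨le_rfl, mul_lt_mul_of_pos_right (lt_add_one _) hh⟩
  exact (iInf₂_le _ hk).trans (le_iSup₂ (f := fun y (_ : y ∈ Ico _ _) => (g y : ℝ≥0∞)) _ hk)

theorem volume_Ico_mul (h : ℝ≥0) (k : ℕ) :
    volume (Ico ((k : ℝ) * h) ((k + 1) * h)) = h := by
  rw [Real.volume_Ico, show ((k : ℝ) + 1) * h - k * h = h by ring, ENNReal.ofReal_coe_nnreal]

theorem lintegral_le_upperSum (g : ℝ≥0 → ℝ≥0) {h : ℝ≥0} (hh : 0 < h) :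
    ∫⁻ y in Ici (0 : ℝ), (g y.toNNReal : ℝ≥0∞) ≤ upperSum g h := by
  have := lintegral_le_tsum_iSup g hh volume measurable_id measurableSet_Ici
    (A := Ici (0 : ℝ)) fun y hy => hy
  simpa only [id, preimage_id_eq, volume_Ico_mul, ← upperSum_eq] using this

theorem lowerSum_le_lintegral (g : ℝ≥0 → ℝ≥0) {h : ℝ≥0} (hh : 0 < h) :
    lowerSum g h ≤ ∫⁻ y in Ici (0 : ℝ), (g y.toNNReal : ℝ≥0∞) := by
  have := tsum_iInf_le_lintegral g hh volume measurable_id measurableSet_Ici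
    (A := Ici (0 : ℝ)) fun y hy => hy
  have hsub : ∀ k : ℕ, Ico ((k : ℝ) * h) ((k + 1) * h) ∩ Ici 0 = Ico ((k : ℝ) * h) ((k + 1) * h) :=
    fun k => inter_eq_left.2 fun x hx => le_trans (by positivity) hx.1
  simpa only [id, preimage_id_eq, hsub, volume_Ico_mul, ← lowerSum_eq] using this

namespace DirectlyRiemannIntegrable

variable {g : ℝ≥0 → ℝ≥0}

theorem tsum_iSup_ne_top (hg : DirectlyRiemannIntegrable g) {h : ℝ≥0} (hh : 0 < h) :
    ∑' k : ℕ, ⨆ y ∈ Ico (k * h) ((k + 1) * h), (g y : ℝ≥0∞) ≠ ∞ := by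
  intro htop
  have := hg.upperSum_lt_top h hh
  rw [upperSum, htop, ENNReal.mul_top (by simpa using hh.ne')] at this
  exact lt_irrefl _ this

theorem lintegral_lt_top (hg : DirectlyRiemannIntegrable g) :
    ∫⁻ y in Ici (0 : ℝ), (g y.toNNReal : ℝ≥0∞) < ∞ :=
  (lintegral_le_upperSum g one_pos).trans_lt (hg.upperSum_lt_top 1 one_pos)

variable {M : Measure ℝ}

theorem lintegral_Icc_lt_top (hg : DirectlyRiemannIntegrable g)
    (hbd : UniformlyLocallyFinite M) (t : ℝ) :
    ∫⁻ y in Icc 0 t, (g (t - y).toNNReal : ℝ≥0∞) ∂M < ∞ := by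
  obtain ⟨C, hC, hMC⟩ := hbd 1
  refine (lintegral_le_tsum_iSup g one_pos M (φ := fun y => t - y) (by fun_prop) measurableSet_Icc
    fun y hy => sub_nonneg.2 hy.2).trans_lt ?_
  calc _ ≤ ∑' k : ℕ, (⨆ y ∈ Ico (k * (1 : ℝ≥0)) ((k + 1) * 1), (g y : ℝ≥0∞)) * C := by
        refine ENNReal.tsum_le_tsum fun k => ?_
        gcongr
        rw [preimage_const_sub_Ico]
        convert! hMC (t - ((k : ℝ) + 1)) using 3 <;> simp
        ring
    _ < ∞ := by
        rw [ENNReal.tsum_mul_right]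
        exact ENNReal.mul_lt_top (hg.tsum_iSup_ne_top one_pos).lt_top hC.lt_top

variable {c : ℝ≥0∞}

/-- For each mesh `h` the limsup is at most `c` times the upper sum and the liminf at least `c`
times the lower sum; the two sums enclose `∫ g` and their gap tends to `0`. The family `A` covers
`[0, t]` and `(0, t]` at once. -/
theorem tendsto_lintegral_of_vague (hg : DirectlyRiemannIntegrable g) (hc : c ≠ ∞)
    (hbd : UniformlyLocallyFinite M)
    (hM : ∀ z : ℝ → ℝ≥0, Continuous z → HasCompactSupport z →
      Tendsto (fun t : ℝ => ∫⁻ y, (z (t - y) : ℝ≥0∞) ∂M) atTop (𝓝 (c * ∫⁻ x, (z x : ℝ≥0∞))))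
    {A : ℝ → Set ℝ} (hA : ∀ t, MeasurableSet (A t)) (hA1 : ∀ t, Ioc 0 t ⊆ A t)
    (hA2 : ∀ t, A t ⊆ Icc 0 t) :
    Tendsto (fun t : ℝ => ∫⁻ y in A t, (g (t - y).toNNReal : ℝ≥0∞) ∂M) atTop
      (𝓝 (c * ∫⁻ y in Ici (0 : ℝ), (g y.toNNReal : ℝ≥0∞))) := by
  have hnonneg : ∀ t, ∀ y ∈ A t, 0 ≤ t - y := fun t y hy => sub_nonneg.2 (hA2 t hy).2
  have hint : ∀ (h : ℝ≥0) (k : ℕ), Tendsto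
      (fun t : ℝ => M (Ioc (t - (k + 1) * h) (t - k * h))) atTop (𝓝 (c * h)) := by
    intro h k
    have := tendsto_measure_Ioc_of_vague hc hM (k * h) ((k + 1) * h)
    rwa [show ((k : ℝ) + 1) * h - k * h = h by ring, ENNReal.ofReal_coe_nnreal] at this
  have hbd' : ∀ h : ℝ≥0, ∃ C : ℝ≥0∞, C ≠ ∞ ∧ ∀ (t : ℝ) (k : ℕ),
      M (Ioc (t - (k + 1) * h) (t - k * h)) ≤ C := by
    intro h
    obtain ⟨C, hC, hMC⟩ := hbd h
    refine ⟨C, hC, fun t k => ?_⟩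
    convert! hMC (t - ((k : ℝ) + 1) * h) using 3
    ring
  have hup : ∀ h : ℝ≥0, 0 < h → limsup (fun t : ℝ => ∫⁻ y in A t, (g (t - y).toNNReal : ℝ≥0∞) ∂M)
      atTop ≤ c * upperSum g h := by
    intro h hh
    obtain ⟨C, hC, hMC⟩ := hbd' h
    have hlim := tendsto_tsum_mul_of_dominated (l := atTop) (hg.tsum_iSup_ne_top hh) hC hMC
      (hint h)
    have hval : c * upperSum g h =
        ∑' k : ℕ, (⨆ y ∈ Ico (k * h) ((k + 1) * h), (g y : ℝ≥0∞)) * (c * h) := by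
      rw [upperSum, ENNReal.tsum_mul_right]
      ring
    rw [hval, ← hlim.limsup_eq]
    refine limsup_le_limsup (Eventually.of_forall fun t => ?_)
    have := lintegral_le_tsum_iSup g hh M (φ := fun y => t - y) (by fun_prop) (hA t) (hnonneg t)
    simpa only [preimage_const_sub_Ico] using this
  have hlow : ∀ h : ℝ≥0, 0 < h → c * lowerSum g h ≤
      liminf (fun t : ℝ => ∫⁻ y in A t, (g (t - y).toNNReal : ℝ≥0∞) ∂M) atTop := by
    intro h hh
    obtain ⟨C, hC, hMC⟩ := hbd' h
    have hs : ∑' k : ℕ, ⨅ y ∈ Ico (k * h) ((k + 1) * h), (g y : ℝ≥0∞) ≠ ∞ :=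
      ne_top_of_le_ne_top (hg.tsum_iSup_ne_top hh)
        (ENNReal.tsum_le_tsum fun k => iInf_Ico_le_iSup_Ico g hh k)
    -- A fixed interval lies inside `A t` only once `t > (k + 1) h`. Convergence for each single `k`
    -- is all that dominated convergence asks for.
    have hlim := tendsto_tsum_mul_of_dominated (l := atTop) hs hC
      (m := fun t k => M (Ioc (t - (k + 1) * h) (t - k * h) ∩ A t))
      (fun t k => (measure_mono inter_subset_left).trans (hMC t k)) (q := fun _ => c * h) (by
        intro k
        refine (hint h k).congr' ?_
        filter_upwards [eventually_gt_atTop (((k : ℝ) + 1) * h)] with t ht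
        rw [inter_eq_left.2]
        refine fun y hy => hA1 t ⟨by linarith [hy.1], hy.2.trans ?_⟩
        have : 0 ≤ (k : ℝ) * h := by positivity
        linarith)
    have hval : c * lowerSum g h =
        ∑' k : ℕ, (⨅ y ∈ Ico (k * h) ((k + 1) * h), (g y : ℝ≥0∞)) * (c * h) := by
      rw [lowerSum, ENNReal.tsum_mul_right]
      ring
    rw [hval, ← hlim.liminf_eq]
    refine liminf_le_liminf (Eventually.of_forall fun t => ?_)
    have := tsum_iInf_le_lintegral g hh M (φ := fun y => t - y) (by fun_prop) (hA t) (hnonneg t)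
    simpa only [preimage_const_sub_Ico] using this
  have hle : ∀ h, upperSum g h ≤ lowerSum g h + (upperSum g h - lowerSum g h) := fun h =>
    le_add_tsub
  set J := ∫⁻ y in Ici (0 : ℝ), (g y.toNNReal : ℝ≥0∞) with hJ
  have herr : ∀ B : ℝ≥0∞, Tendsto (fun h => B + c * (upperSum g h - lowerSum g h)) (𝓝[>] 0) (𝓝 B) :=
    fun B => by
      simpa using (tendsto_const_nhds (x := B)).add
        (ENNReal.Tendsto.const_mul hg.tendsto_sub (Or.inr hc))
  refine tendsto_of_le_liminf_of_limsup_le ?_ ?_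
  · refine ge_of_tendsto (herr _) ?_
    filter_upwards [self_mem_nhdsWithin] with h hh
    calc c * J ≤ c * (lowerSum g h + (upperSum g h - lowerSum g h)) := by
          gcongr
          exact (lintegral_le_upperSum g hh).trans (hle h)
      _ ≤ _ := by
          rw [mul_add]
          gcongr
          exact hlow h hh
  · refine ge_of_tendsto (herr _) ?_
    filter_upwards [self_mem_nhdsWithin] with h hh
    calc _ ≤ c * (lowerSum g h + (upperSum g h - lowerSum g h)) := by
          refine (hup h hh).trans ?_
          gcongr
          exact hle h
      _ ≤ _ := by
          rw [mul_add]
          gcongr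
          exact lowerSum_le_lintegral g hh

end DirectlyRiemannIntegrable

end DirectRiemann

/-! ### Asymptotic constancy of solutions of the renewal equation. -/

section Increments

variable {F : Measure ℝ} [IsProbabilityMeasure F]

/-- Asymptotic maximum principle: up to `r`, `w t` is an average of the values `w (t - x)`, which
asymptotically do not exceed `η`. If the average is close to `η`, then `w` cannot be much smaller
than `η` near `t - a`, since a neighbourhood of `a` carries mass. -/
theorem near_sup_of_near_sup_sub {w r : ℝ → ℝ} {B η a ε : ℝ} (hB : ∀ t, |w t| ≤ B)
    (huc : UniformContinuous w) (hr : Tendsto r atTop (𝓝 0))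
    (hw : ∀ t, w t = r t + ∫ x, w (t - x) ∂F) (hη : ∀ ε > 0, ∀ᶠ t in atTop, w t < η + ε)
    (ha : a ∈ F.support) (hε : 0 < ε) :
    ∃ ε' > 0, ∀ᶠ t in atTop, η - ε' < w t → η - ε < w (t - a) := by
  obtain ⟨δ, hδ, hwδ⟩ := Metric.uniformContinuous_iff.1 huc (ε / 2) (half_pos hε)
  set p := F.real (Metric.ball a δ) with hp
  have hp0 : 0 < p := ENNReal.toReal_pos
    ((Measure.mem_support_iff_forall a).1 ha _ (Metric.ball_mem_nhds a hδ)).ne' (measure_ne_top _ _)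
  have hcw := huc.continuous
  -- The bound by `η` holds only eventually, and not uniformly in `x`; the mean excess over `η`
  -- still vanishes by dominated convergence.
  have hexc : Tendsto (fun t => ∫ x, max (w (t - x) - η) 0 ∂F) atTop (𝓝 (∫ _, (0 : ℝ) ∂F)) := by
    refine tendsto_integral_filter_of_dominated_convergence (fun _ => B + |η|)
      (Eventually.of_forall fun t => Continuous.aestronglyMeasurable (by fun_prop))
      (Eventually.of_forall fun t => Eventually.of_forall fun x => ?_) (integrable_const _)
      (Eventually.of_forall fun x => ?_)
    · have h1 := abs_le.1 (hB (t - x))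
      have h2 := neg_abs_le η
      rw [Real.norm_of_nonneg (le_max_right _ _)]
      exact max_le (by linarith [h1.2]) (by linarith [abs_nonneg η, h1.1, h1.2])
    · have hsh : Tendsto (fun t : ℝ => t - x) atTop atTop :=
        tendsto_atTop_add_const_right _ _ tendsto_id
      refine Metric.tendsto_nhds.2 fun e he => ?_
      filter_upwards [hsh.eventually (hη e he)] with t ht
      rw [Real.dist_eq, sub_zero, abs_of_nonneg (le_max_right _ _)]
      exact max_lt (by linarith) he
  rw [integral_zero] at hexc
  have hκ : 0 < ε * p / 8 := by positivity
  -- A deficit `ε / 2` on the ball costs `ε p / 2`, while the excess and `r t` each contribute less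
  -- than `ε p / 8`. This would give `w t < η - ε p / 4`.
  refine ⟨ε * p / 8, hκ, ?_⟩
  filter_upwards [hexc.eventually (gt_mem_nhds hκ), hr.eventually (gt_mem_nhds hκ)] with t h1 h2 h3
  by_contra! h4
  have hbd : Integrable (fun x => w (t - x)) F :=
    Integrable.of_bound (Continuous.aestronglyMeasurable (by fun_prop)) B
      (Eventually.of_forall fun x => hB _)
  have hmax : Integrable (fun x => max (w (t - x) - η) 0) F :=
    (hbd.sub (integrable_const η)).pos_part
  have hind : Integrable ((Metric.ball a δ).indicator fun _ => ε / 2) F :=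
    (integrable_const _).indicator Metric.isOpen_ball.measurableSet
  have hle : ∫ x, w (t - x) ∂F ≤
      ∫ x, (η + max (w (t - x) - η) 0 - (Metric.ball a δ).indicator (fun _ => ε / 2) x) ∂F := by
    refine integral_mono hbd (((integrable_const η).add hmax).sub hind) fun x => ?_
    dsimp only
    by_cases hx : x ∈ Metric.ball a δ
    · rw [indicator_of_mem hx]
      have := hwδ (a := t - x) (b := t - a) (by
        rw [Metric.mem_ball, Real.dist_eq] at hx
        rwa [Real.dist_eq, show t - x - (t - a) = -(x - a) by ring, abs_neg])
      rw [Real.dist_eq] at this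
      have := (abs_lt.1 this).2
      linarith [le_max_right (w (t - x) - η) 0]
    · rw [indicator_of_notMem hx]
      linarith [le_max_left (w (t - x) - η) 0]
  have hadd : Integrable (fun x => η + max (w (t - x) - η) 0) F := (integrable_const η).add hmax
  rw [integral_sub hadd hind, integral_add (integrable_const η) hmax,
    integral_indicator_const _ Metric.isOpen_ball.measurableSet] at hle
  simp only [integral_const, probReal_univ, smul_eq_mul, one_mul] at hle
  rw [← hp] at hle
  have := hw t
  nlinarith

theorem near_sup_of_near_sup_sub_mul {w r : ℝ → ℝ} {B η a : ℝ} (hB : ∀ t, |w t| ≤ B)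
    (huc : UniformContinuous w) (hr : Tendsto r atTop (𝓝 0))
    (hw : ∀ t, w t = r t + ∫ x, w (t - x) ∂F) (hη : ∀ ε > 0, ∀ᶠ t in atTop, w t < η + ε)
    (ha : a ∈ F.support) (K : ℕ) : ∀ ε > 0,
    ∃ ε' > 0, ∀ᶠ t in atTop, η - ε' < w t → ∀ k ≤ K, η - ε < w (t - k * a) := by
  induction K with
  | zero =>
    intro ε hε
    refine ⟨ε, hε, Eventually.of_forall fun t ht k hk => ?_⟩
    obtain rfl : k = 0 := by omega
    simpa using ht
  | succ K ih =>
    intro ε hε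
    obtain ⟨ε₁, hε₁, h1⟩ := near_sup_of_near_sup_sub hB huc hr hw hη ha hε
    obtain ⟨ε₂, hε₂, h2⟩ := ih (min ε ε₁) (lt_min hε hε₁)
    have hsh : Tendsto (fun t : ℝ => t - K * a) atTop atTop :=
      tendsto_atTop_add_const_right _ _ tendsto_id
    refine ⟨ε₂, hε₂, ?_⟩
    filter_upwards [h2, hsh.eventually h1] with t h3 h4 h5 k hk
    rcases Nat.le_succ_iff.1 hk with hk | rfl
    · linarith [h3 h5 k hk, min_le_left ε ε₁]
    · have := h4 (by linarith [h3 h5 K le_rfl, min_le_right ε ε₁])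
      convert! this using 2
      push_cast
      ring

/-- The increment `w t = u t - u (t - a)` solves the same type of equation. If its limsup `η` were
positive, some `t` would have `w` above `η / 2` at many consecutive points `t, t - a, t - 2a, …`.
These increments telescope, so `u` would vary by more than its bound allows. -/
theorem eventually_sub_lt_of_mem_support {u r : ℝ → ℝ} {B a : ℝ} (hB : ∀ t, |u t| ≤ B)
    (huc : UniformContinuous u) (hr : Tendsto r atTop (𝓝 0))
    (hu : ∀ t, u t = r t + ∫ x, u (t - x) ∂F) (ha : a ∈ F.support) {ε : ℝ} (hε : 0 < ε) :
    ∀ᶠ t in atTop, u t - u (t - a) < ε := by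
  set w : ℝ → ℝ := fun t => u t - u (t - a) with hwdef
  have hsub : UniformContinuous fun t : ℝ => u (t - a) :=
    huc.comp (uniformContinuous_id.sub uniformContinuous_const)
  have hwuc : UniformContinuous w := huc.sub hsub
  have hwB : ∀ t, |w t| ≤ 2 * B := fun t => by
    have h1 := abs_le.1 (hB t)
    have h2 := abs_le.1 (hB (t - a))
    exact abs_le.2 ⟨by linarith [h1.1, h2.2], by linarith [h1.2, h2.1]⟩
  have hint : ∀ s, Integrable (fun x => u (s - x)) F := fun s =>
    Integrable.of_bound (huc.continuous.comp (by fun_prop)).aestronglyMeasurable B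
      (Eventually.of_forall fun x => hB _)
  have hw : ∀ t, w t = (r t - r (t - a)) + ∫ x, w (t - x) ∂F := by
    intro t
    simp only [hwdef]
    have : (fun x => u (t - x) - u (t - x - a)) = fun x => u (t - x) - u (t - a - x) := by
      funext x
      rw [sub_right_comm]
    rw [this, integral_sub (hint t) (hint (t - a)), hu t, hu (t - a), ← hu t, ← hu (t - a)]
    linarith [hu t, hu (t - a)]
  have hr' : Tendsto (fun t => r t - r (t - a)) atTop (𝓝 0) := by
    simpa [sub_eq_add_neg] using hr.sub (hr.comp (tendsto_atTop_add_const_right _ (-a) tendsto_id))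
  have hbdd : IsBoundedUnder (· ≤ ·) atTop w :=
    isBoundedUnder_of ⟨2 * B, fun t => (abs_le.1 (hwB t)).2⟩
  have hcob : IsCoboundedUnder (· ≤ ·) atTop w :=
    IsBoundedUnder.isCoboundedUnder_le (isBoundedUnder_of ⟨-(2 * B), fun t => (abs_le.1 (hwB t)).1⟩)
  set η := limsup w atTop with hηdef
  have hη : ∀ ε > 0, ∀ᶠ t in atTop, w t < η + ε := fun ε hε =>
    eventually_lt_of_limsup_lt (by linarith) hbdd
  suffices hη0 : η ≤ 0 from eventually_lt_of_limsup_lt (by linarith) hbdd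
  by_contra! hη0
  -- With this choice `K` increments of size `η / 2` exceed `2B`, the largest possible oscillation
  -- of `u`.
  obtain ⟨K, hK⟩ := exists_nat_gt (2 * B / (η / 2))
  rw [div_lt_iff₀ (by positivity)] at hK
  obtain ⟨ε', hε', hev⟩ := near_sup_of_near_sup_sub_mul hwB hwuc hr' hw hη ha K (η / 2)
    (half_pos hη0)
  obtain ⟨t, ht1, ht2⟩ := ((frequently_lt_of_lt_limsup hcob
    (show η - ε' < limsup w atTop by linarith)).and_eventually hev).exists
  have hsum : ∑ k ∈ Finset.range K, w (t - k * a) = u t - u (t - K * a) := by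
    have := Finset.sum_range_sub' (fun k : ℕ => u (t - k * a)) K
    simp only [Nat.cast_zero, zero_mul, sub_zero] at this
    rw [← this]
    refine Finset.sum_congr rfl fun k _ => ?_
    simp only [hwdef]
    congr 2
    push_cast
    ring
  have hge : (K : ℝ) * (η / 2) ≤ ∑ k ∈ Finset.range K, w (t - k * a) := by
    have := Finset.card_nsmul_le_sum (Finset.range K) (fun k : ℕ => w (t - k * a)) (η / 2)
      fun k hk => by linarith [ht2 ht1 k (Finset.mem_range.1 hk).le]
    simpa using this
  have h1 := abs_le.1 (hB t)
  have h2 := abs_le.1 (hB (t - K * a))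
  linarith [h1.2, h2.1]

theorem tendsto_sub_of_mem_support {u r : ℝ → ℝ} {B a : ℝ} (hB : ∀ t, |u t| ≤ B)
    (huc : UniformContinuous u) (hr : Tendsto r atTop (𝓝 0))
    (hu : ∀ t, u t = r t + ∫ x, u (t - x) ∂F) (ha : a ∈ F.support) :
    Tendsto (fun t => u t - u (t - a)) atTop (𝓝 0) := by
  refine Metric.tendsto_nhds.2 fun ε hε => ?_
  have h1 := eventually_sub_lt_of_mem_support hB huc hr hu ha hε
  have h2 := eventually_sub_lt_of_mem_support (u := fun t => -u t) (r := fun t => -r t) (B := B)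
    (fun t => by simpa using hB t) huc.neg (by simpa using hr.neg)
    (fun t => by rw [integral_neg, hu t, ← hu t]; linarith [hu t]) ha hε
  filter_upwards [h1, h2] with t h3 h4
  rw [Real.dist_eq, sub_zero, abs_lt]
  constructor <;> linarith

/-- The good shifts `a` form a subgroup of `ℝ`, closed by uniform continuity of `u`, which contains
the support of `F`. A subgroup of `ℝ` is dense or cyclic, and a cyclic one would make `F`
arithmetic. -/
theorem tendsto_sub_of_nonarithmetic {u r : ℝ → ℝ} {B : ℝ} (hB : ∀ t, |u t| ≤ B)
    (huc : UniformContinuous u) (hr : Tendsto r atTop (𝓝 0))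
    (hu : ∀ t, u t = r t + ∫ x, u (t - x) ∂F)
    (hF : ∀ h : ℝ, 0 < h → ¬ ∀ᵐ x ∂F, ∃ k : ℤ, x = k * h) (a : ℝ) :
    Tendsto (fun t => u t - u (t - a)) atTop (𝓝 0) := by
  have hsh : ∀ b : ℝ, Tendsto (fun t : ℝ => t + b) atTop atTop := fun b =>
    tendsto_atTop_add_const_right _ _ tendsto_id
  let G : AddSubgroup ℝ :=
    { carrier := {a | Tendsto (fun t => u t - u (t - a)) atTop (𝓝 0)}
      zero_mem' := by simp
      add_mem' := by
        intro a b ha hb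
        have := Tendsto.add ha (Tendsto.comp hb (hsh (-a)))
        simp only [add_zero] at this
        refine this.congr fun t => ?_
        simp only [Function.comp_apply]
        rw [show t - (a + b) = t + -a - b by ring, ← sub_eq_add_neg t a]
        ring
      neg_mem' := by
        intro a ha
        have := (Tendsto.comp ha (hsh a)).neg
        simp only [neg_zero] at this
        refine this.congr fun t => ?_
        simp }
  have hGmem : ∀ a, a ∈ G ↔ Tendsto (fun t => u t - u (t - a)) atTop (𝓝 0) := fun a => Iff.rfl
  have hclosed : closure (G : Set ℝ) ⊆ G := by
    intro a ha
    refine (hGmem a).2 (Metric.tendsto_nhds.2 fun ε hε => ?_)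
    obtain ⟨δ, hδ, hwδ⟩ := Metric.uniformContinuous_iff.1 huc (ε / 2) (half_pos hε)
    obtain ⟨b, hb, hab⟩ := Metric.mem_closure_iff.1 ha δ hδ
    filter_upwards [Metric.tendsto_nhds.1 ((hGmem b).1 hb) (ε / 2) (half_pos hε)] with t ht
    have h1 := hwδ (a := t - b) (b := t - a) (by
      rwa [Real.dist_eq, show t - b - (t - a) = a - b by ring, ← Real.dist_eq])
    rw [Real.dist_eq] at h1 ht ⊢
    calc |u t - u (t - a) - 0| = |(u t - u (t - b) - 0) + (u (t - b) - u (t - a))| := by ring_nf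
      _ ≤ _ := abs_add_le _ _
      _ < ε := by linarith
  have hsupp : F.support ⊆ G := fun a ha => tendsto_sub_of_mem_support hB huc hr hu ha
  rcases G.dense_or_cyclic with hd | ⟨b, hb⟩
  · exact hclosed (hd a)
  · exfalso
    have hae : ∀ᵐ x ∂F, x ∈ AddSubgroup.closure {b} := by
      filter_upwards [Measure.support_mem_ae (μ := F)] with x hx
      exact hb ▸ hsupp hx
    simp only [AddSubgroup.mem_closure_singleton, zsmul_eq_mul] at hae
    -- The generator may have either sign. If it is `0`, then `F` is concentrated at `0` and any
    -- span, such as `1`, gives a contradiction.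
    rcases lt_trichotomy b 0 with h | rfl | h
    · refine hF (-b) (by linarith) ?_
      filter_upwards [hae] with x ⟨k, hk⟩
      exact ⟨-k, by push_cast; linarith⟩
    · refine hF 1 one_pos ?_
      filter_upwards [hae] with x ⟨k, hk⟩
      exact ⟨0, by simp at hk ⊢; exact hk.symm⟩
    · refine hF b h ?_
      filter_upwards [hae] with x ⟨k, hk⟩
      exact ⟨k, hk.symm⟩

end Increments

/-! ### The renewal measure of the parent points. -/

section RenewalMeasure

theorem conv_apply_eq_lintegral (M N : Measure ℝ) [SFinite N] {B : Set ℝ} (hB : MeasurableSet B) :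
    (M ∗ N) B = ∫⁻ s, N ((fun x => s + x) ⁻¹' B) ∂M := by
  rw [← lintegral_indicator_one hB, Measure.lintegral_conv (measurable_one.indicator hB)]
  refine lintegral_congr fun s => ?_
  rw [← lintegral_indicator_one (measurable_const_add s hB)]
  rfl

/-- The law of the `n`-th point of a renewal process with delay law `D` and increment law `F`. -/
noncomputable def pointLaw (D F : Measure ℝ) : ℕ → Measure ℝ
  | 0 => D
  | n + 1 => pointLaw D F n ∗ F

/-- The mean measure of a renewal process with delay law `D` and increment law `F`. -/
noncomputable def delayedRenewalMeasure (D F : Measure ℝ) : Measure ℝ :=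
  Measure.sum (pointLaw D F)

/-- The survival function `y ↦ F (y, ∞)` on `[0, ∞)`, extended by zero. -/
noncomputable def survival (F : Measure ℝ) : ℝ → ℝ≥0∞ :=
  (Ici 0).indicator fun y => F (Ioi y)

theorem measurable_survival (F : Measure ℝ) : Measurable (survival F) :=
  Measurable.indicator
    (Antitone.measurable fun _ _ hab => measure_mono (Ioi_subset_Ioi hab)) measurableSet_Ici

/-- Layer-cake formula for the mean. -/
theorem lintegral_survival {F : Measure ℝ} [SFinite F] (hF : F (Iio 0) = 0)
    (hint : Integrable (fun x => x) F) :
    ∫⁻ y, survival F y = ENNReal.ofReal (∫ x, x ∂F) := by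
  have hnn : 0 ≤ᵐ[F] fun x => x := by
    filter_upwards [measure_eq_zero_iff_ae_notMem.1 hF] with x hx
    simpa using hx
  rw [ofReal_integral_eq_lintegral_ofReal hint hnn,
    lintegral_eq_lintegral_meas_lt F hnn aemeasurable_id, survival,
    lintegral_indicator measurableSet_Ici, setLIntegral_congr Ioi_ae_eq_Ici.symm]
  rfl

theorem exists_measure_Ioi_ne_zero {F : Measure ℝ} (hpos : 0 < ∫ x, x ∂F) :
    ∃ δ > 0, F (Ioi δ) ≠ 0 := by
  by_contra! h
  have h0 : F (Ioi 0) = 0 := by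
    have hU : Ioi (0 : ℝ) = ⋃ n : ℕ, Ioi (1 / ((n : ℝ) + 1)) := by
      ext x
      simp only [mem_Ioi, mem_iUnion]
      exact ⟨fun hx => exists_nat_one_div_lt hx, fun ⟨n, hn⟩ => lt_trans (by positivity) hn⟩
    rw [hU]
    exact measure_iUnion_null fun n => h _ (by positivity)
  have : ∫ x, x ∂F ≤ 0 := by
    refine integral_nonpos_of_ae ?_
    filter_upwards [measure_eq_zero_iff_ae_notMem.1 h0] with x hx
    simpa using hx
  linarith

theorem lintegral_delayedRenewalMeasure {D F : Measure ℝ} [SFinite F] {f : ℝ → ℝ≥0∞}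
    (hf : Measurable f) :
    ∫⁻ s, f s ∂delayedRenewalMeasure D F =
      ∫⁻ s, f s ∂D + ∫⁻ s, ∫⁻ x, f (s + x) ∂F ∂delayedRenewalMeasure D F := by
  simp only [delayedRenewalMeasure, lintegral_sum_measure]
  rw [tsum_eq_zero_add' ENNReal.summable]
  congr 1
  exact tsum_congr fun n => Measure.lintegral_conv hf

variable {D F : Measure ℝ} [IsProbabilityMeasure F]

theorem pointLaw_Iio (hD : D (Iio 0) = 0) (hF : F (Iio 0) = 0) (n : ℕ) :
    pointLaw D F n (Iio 0) = 0 := by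
  induction n with
  | zero => exact hD
  | succ n ih =>
    rw [pointLaw, conv_apply_eq_lintegral _ _ measurableSet_Iio]
    refine lintegral_eq_zero_of_ae_eq_zero ?_
    have : ∀ᵐ s ∂pointLaw D F n, s ∉ Iio 0 := measure_eq_zero_iff_ae_notMem.1 ih
    filter_upwards [this] with s hs
    refine measure_mono_null (fun x hx => ?_) hF
    simp only [mem_preimage, mem_Iio, not_lt] at hx hs ⊢
    linarith

/-- As the steps are nonnegative, `S_n ≤ t` splits into `S_{n+1} ≤ t` and `S_n ≤ t < S_{n+1}`; the
survival function gives the probability of the second event. -/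
theorem pointLaw_Iic (hF : F (Iio 0) = 0) (n : ℕ) (t : ℝ) :
    pointLaw D F n (Iic t) =
      pointLaw D F (n + 1) (Iic t) + ∫⁻ s, survival F (t - s) ∂pointLaw D F n := by
  have hpre : ∀ s, (fun x => s + x) ⁻¹' Iic t = Iic (t - s) := fun s => by
    ext x
    simp [le_sub_iff_add_le']
  rw [pointLaw, conv_apply_eq_lintegral _ _ measurableSet_Iic,
    ← lintegral_add_right _ (show Measurable fun s => survival F (t - s) from
      (measurable_survival F).comp (by fun_prop)),
    ← lintegral_indicator_one measurableSet_Iic]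
  refine lintegral_congr fun s => ?_
  rw [hpre, survival]
  by_cases hs : s ≤ t
  · rw [indicator_of_mem (show s ∈ Iic t from hs),
      indicator_of_mem (show t - s ∈ Ici 0 from sub_nonneg.2 hs), ← compl_Iic,
      measure_add_measure_compl measurableSet_Iic]
    simp
  · rw [indicator_of_notMem (show s ∉ Iic t from hs),
      indicator_of_notMem (show t - s ∉ Ici 0 from fun h => hs (sub_nonneg.1 h)), add_zero]
    refine (measure_mono_null (fun x hx => ?_) hF).symm
    simp only [mem_Iic, mem_Iio] at hx ⊢
    linarith

theorem delayedRenewalMeasure_Iio (hD : D (Iio 0) = 0) (hF : F (Iio 0) = 0) :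
    delayedRenewalMeasure D F (Iio 0) = 0 := by
  simp [delayedRenewalMeasure, Measure.sum_apply _ measurableSet_Iio, pointLaw_Iio hD hF]

theorem pointLaw_zero_Iic (hF : F (Iio 0) = 0) (N : ℕ) (t : ℝ) :
    D (Iic t) = pointLaw D F N (Iic t) +
      ∑ n ∈ Finset.range N, ∫⁻ s, survival F (t - s) ∂pointLaw D F n := by
  induction N with
  | zero => simp [pointLaw]
  | succ N ih => rw [ih, Finset.sum_range_succ, pointLaw_Iic hF N t]; ring

variable [IsProbabilityMeasure D]

instance isProbabilityMeasure_pointLaw (n : ℕ) : IsProbabilityMeasure (pointLaw D F n) := by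
  induction n with
  | zero => exact ‹IsProbabilityMeasure D›
  | succ n ih =>
    refine ⟨?_⟩
    rw [pointLaw, conv_apply_eq_lintegral _ _ MeasurableSet.univ]
    simp

instance sFinite_delayedRenewalMeasure : SFinite (delayedRenewalMeasure D F) := by
  unfold delayedRenewalMeasure
  infer_instance

theorem survival_le_one (y : ℝ) : survival F y ≤ 1 :=
  indicator_le (fun _ _ => prob_le_one) y

theorem lintegral_survival_le_one (hF : F (Iio 0) = 0) (t : ℝ) :
    ∫⁻ s, survival F (t - s) ∂delayedRenewalMeasure D F ≤ 1 := by
  rw [delayedRenewalMeasure, lintegral_sum_measure]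
  refine ENNReal.tsum_le_of_sum_range_le fun N => ?_
  calc _ ≤ D (Iic t) := by rw [pointLaw_zero_Iic hF N t]; exact le_add_self
    _ ≤ 1 := prob_le_one

/-- On `[a, a + δ]` the function `s ↦ survival F (a + δ - s)` is at least `F(δ, ∞)`, while its
integral is at most `1`. This bounds the mass of each interval of length `δ` by `F(δ, ∞)⁻¹`, and
longer intervals are covered by such ones. -/
theorem uniformlyLocallyFinite_delayedRenewalMeasure (hF : F (Iio 0) = 0)
    (hpos : 0 < ∫ x, x ∂F) : UniformlyLocallyFinite (delayedRenewalMeasure D F) := by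
  intro h
  obtain ⟨δ, hδ, hp⟩ := exists_measure_Ioi_ne_zero hpos
  have hshort : ∀ a, delayedRenewalMeasure D F (Icc a (a + δ)) ≤ (F (Ioi δ))⁻¹ := by
    intro a
    rw [ENNReal.le_inv_iff_mul_le, mul_comm]
    calc F (Ioi δ) * delayedRenewalMeasure D F (Icc a (a + δ))
        = ∫⁻ s, (Icc a (a + δ)).indicator (fun _ => F (Ioi δ)) s ∂delayedRenewalMeasure D F :=
          (lintegral_indicator_const measurableSet_Icc _).symm
      _ ≤ ∫⁻ s, survival F (a + δ - s) ∂delayedRenewalMeasure D F := by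
          refine lintegral_mono fun s => ?_
          by_cases hs : s ∈ Icc a (a + δ)
          swap
          · simp [hs]
          rw [indicator_of_mem hs, survival,
            indicator_of_mem (show a + δ - s ∈ Ici 0 from sub_nonneg.2 hs.2)]
          exact measure_mono (Ioi_subset_Ioi (by linarith [hs.1]))
      _ ≤ 1 := lintegral_survival_le_one hF _
  obtain ⟨n, hn⟩ := exists_nat_gt (h / δ)
  rw [div_lt_iff₀ hδ] at hn
  refine ⟨n * (F (Ioi δ))⁻¹, ENNReal.mul_ne_top (by simp) (by simpa using hp), fun a => ?_⟩
  have hcover : Ioc a (a + h) ⊆ ⋃ k ∈ Finset.range n, Icc (a + k * δ) (a + k * δ + δ) := by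
    intro x hx
    have hx0 : 0 ≤ (x - a) / δ := div_nonneg (by linarith [hx.1]) hδ.le
    have h1 := Nat.floor_le hx0
    have h2 := Nat.lt_floor_add_one ((x - a) / δ)
    rw [le_div_iff₀ hδ] at h1
    rw [div_lt_iff₀ hδ] at h2
    simp only [mem_iUnion, Finset.mem_range, exists_prop]
    refine ⟨⌊(x - a) / δ⌋₊, ?_, by linarith, by linarith⟩
    rw [Nat.floor_lt hx0, div_lt_iff₀ hδ]
    linarith [hx.2]
  calc _ ≤ ∑ k ∈ Finset.range n, delayedRenewalMeasure D F (Icc (a + k * δ) (a + k * δ + δ)) :=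
        (measure_mono hcover).trans (measure_biUnion_finset_le _ _)
    _ ≤ ∑ k ∈ Finset.range n, (F (Ioi δ))⁻¹ := Finset.sum_le_sum fun k _ => hshort _
    _ = _ := by simp

theorem exists_delayedRenewalMeasure_Iic_le (hD : D (Iio 0) = 0) (hF : F (Iio 0) = 0)
    (hpos : 0 < ∫ x, x ∂F) : ∃ C : ℝ≥0∞, C ≠ ∞ ∧
      ∀ t, delayedRenewalMeasure D F (Iic t) ≤ C * ENNReal.ofReal (|t| + 2) := by
  obtain ⟨C, hC, hVC⟩ := uniformlyLocallyFinite_delayedRenewalMeasure (D := D) hF hpos 1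
  refine ⟨C, hC, fun t => ?_⟩
  -- The index `k = 0` gives `(-1, 0]`, which is needed because the half-open intervals must also
  -- capture the point `0`.
  have hcover : Iic t ⊆ Iio 0 ∪
      ⋃ k ∈ Finset.range (⌈|t|⌉₊ + 1), Ioc ((k : ℝ) - 1) ((k : ℝ) - 1 + 1) := by
    intro x hx
    rcases lt_or_ge x 0 with h0 | h0
    · exact Or.inl h0
    · right
      simp only [mem_iUnion, Finset.mem_range, exists_prop, Order.lt_add_one_iff]
      refine ⟨⌈x⌉₊, Nat.ceil_mono (hx.trans (le_abs_self t)), ?_, ?_⟩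
      · linarith [Nat.ceil_lt_add_one h0]
      · linarith [Nat.le_ceil x]
  calc _ ≤ delayedRenewalMeasure D F (Iio 0) + ∑ k ∈ Finset.range (⌈|t|⌉₊ + 1),
          delayedRenewalMeasure D F (Ioc ((k : ℝ) - 1) ((k : ℝ) - 1 + 1)) :=
        (measure_mono hcover).trans ((measure_union_le _ _).trans
          (by gcongr; exact measure_biUnion_finset_le _ _))
    _ ≤ 0 + ∑ k ∈ Finset.range (⌈|t|⌉₊ + 1), C := by
        rw [delayedRenewalMeasure_Iio hD hF]
        gcongr
        exact hVC _
    _ = C * ((⌈|t|⌉₊ + 1 : ℕ) : ℝ≥0∞) := by simp [mul_comm]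
    _ ≤ _ := by
        gcongr
        rw [← ENNReal.ofReal_natCast]
        refine ENNReal.ofReal_le_ofReal ?_
        push_cast
        linarith [Nat.ceil_lt_add_one (abs_nonneg t)]

/-- Each `t` lies before the first point or in exactly one gap between successive points. In the
telescoped identity the remainder `pointLaw D F N (Iic t)` tends to `0`, being the general term of
the convergent series for `V(-∞, t]`. -/
theorem lintegral_survival_eq (hD : D (Iio 0) = 0) (hF : F (Iio 0) = 0) (hpos : 0 < ∫ x, x ∂F)
    (t : ℝ) : ∫⁻ s, survival F (t - s) ∂delayedRenewalMeasure D F = D (Iic t) := by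
  obtain ⟨C, hC, hVC⟩ := exists_delayedRenewalMeasure_Iic_le hD hF hpos
  have hfin : ∑' n, pointLaw D F n (Iic t) ≠ ∞ := by
    rw [← Measure.sum_apply _ measurableSet_Iic]
    exact ne_top_of_le_ne_top (ENNReal.mul_ne_top hC ENNReal.ofReal_ne_top) (hVC t)
  have h1 := ENNReal.tendsto_atTop_zero_of_tsum_ne_top hfin
  have h2 := ENNReal.tendsto_nat_tsum fun n => ∫⁻ s, survival F (t - s) ∂pointLaw D F n
  have h3 := h1.add h2
  simp only [← pointLaw_zero_Iic hF, zero_add] at h3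
  rw [delayedRenewalMeasure, lintegral_sum_measure]
  exact tendsto_nhds_unique h3 tendsto_const_nhds

end RenewalMeasure

/-! ### Convolutions of measures with test functions. -/

section Convolution

theorem exists_bound_of_compactSupport {z : ℝ → ℝ≥0} (hz : Continuous z)
    (hzc : HasCompactSupport z) :
    ∃ (K : ℝ≥0) (R : ℝ), (∀ x, z x ≤ K) ∧ ∀ x, R < |x| → z x = 0 := by
  obtain ⟨K, hK⟩ := hz.bddAbove_range_of_hasCompactSupport hzc
  obtain ⟨R, hR⟩ := hzc.isCompact.isBounded.subset_closedBall 0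
  refine ⟨K, R, fun x => hK (mem_range_self x), fun x hx =>
    image_eq_zero_of_notMem_tsupport fun h => ?_⟩
  have := hR h
  rw [Metric.mem_closedBall, Real.dist_eq, sub_zero] at this
  linarith

theorem tendsto_lintegral_sub_zero (D : Measure ℝ) [IsFiniteMeasure D] {z : ℝ → ℝ≥0}
    (hz : Continuous z) (hzc : HasCompactSupport z) :
    Tendsto (fun t : ℝ => ∫⁻ s, (z (t - s) : ℝ≥0∞) ∂D) atTop (𝓝 0) := by
  obtain ⟨K, R, hK, hR⟩ := exists_bound_of_compactSupport hz hzc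
  rw [← lintegral_zero (μ := D)]
  refine tendsto_lintegral_filter_of_dominated_convergence (fun _ => (K : ℝ≥0∞))
    (Eventually.of_forall fun t => by fun_prop)
    (Eventually.of_forall fun t => Eventually.of_forall fun s => ?_) ?_
    (Eventually.of_forall fun s => ?_)
  · exact ENNReal.coe_le_coe.2 (hK _)
  · simpa using ENNReal.mul_ne_top ENNReal.coe_ne_top (measure_ne_top _ _)
  · refine tendsto_const_nhds.congr' ?_
    filter_upwards [eventually_gt_atTop (R + s)] with t ht
    rw [hR _ (by linarith [le_abs_self (t - s)]), ENNReal.coe_zero]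

theorem UniformlyLocallyFinite.lintegral_sub_le {M : Measure ℝ} (hM : UniformlyLocallyFinite M)
    {z : ℝ → ℝ≥0} (hz : Continuous z) (hzc : HasCompactSupport z) :
    ∃ C : ℝ≥0, ∀ t : ℝ, ∫⁻ s, (z (t - s) : ℝ≥0∞) ∂M ≤ C := by
  obtain ⟨K, R, hK, hR⟩ := exists_bound_of_compactSupport hz hzc
  -- The extra unit of length lets a half-open window `(t - R - 1, t + R]` contain the closed
  -- interval `[t - R, t + R]`, outside which `z (t - s)` vanishes.
  obtain ⟨C, hC, hMC⟩ := hM (2 * R + 1)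
  lift C to ℝ≥0 using hC
  refine ⟨K * C, fun t => ?_⟩
  calc _ ≤ ∫⁻ s, (Ioc (t - R - 1) (t - R - 1 + (2 * R + 1))).indicator
          (fun _ => (K : ℝ≥0∞)) s ∂M := by
        refine lintegral_mono fun s => ?_
        by_cases hs : s ∈ Ioc (t - R - 1) (t - R - 1 + (2 * R + 1))
        · rw [indicator_of_mem hs]
          exact ENNReal.coe_le_coe.2 (hK _)
        · rw [hR, ENNReal.coe_zero]
          · exact zero_le
          · by_contra! h
            rw [abs_le] at h
            exact hs ⟨by linarith, by linarith⟩
    _ ≤ _ := by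
        rw [lintegral_indicator_const measurableSet_Ioc, ENNReal.coe_mul]
        exact mul_le_mul' le_rfl (hMC _)

/-- `z` itself is uniformly continuous, and the pointwise error `ε` is paid only on a window of
fixed length, whose mass is uniformly bounded. A one-sided estimate suffices, since the roles of `t`
and `t'` can be exchanged. -/
theorem UniformlyLocallyFinite.uniformContinuous {M : Measure ℝ} (hM : UniformlyLocallyFinite M)
    {z : ℝ → ℝ≥0} (hz : Continuous z) (hzc : HasCompactSupport z) :
    UniformContinuous fun t : ℝ => (∫⁻ s, (z (t - s) : ℝ≥0∞) ∂M).toReal := by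
  obtain ⟨-, R, -, hR⟩ := exists_bound_of_compactSupport hz hzc
  obtain ⟨C, hC, hMC⟩ := hM (2 * R + 1)
  lift C to ℝ≥0 using hC
  obtain ⟨B, hB⟩ := hM.lintegral_sub_le hz hzc
  have hzu : UniformContinuous z := 
    hz.uniformContinuous_of_tendsto_cocompact hzc.is_zero_at_infty
  have hone : ∀ ε : ℝ≥0, 0 < ε → ∃ δ > 0, ∀ t t' : ℝ, dist t t' < δ →
      (∫⁻ s, (z (t - s) : ℝ≥0∞) ∂M).toReal ≤
        (∫⁻ s, (z (t' - s) : ℝ≥0∞) ∂M).toReal + ε * C := by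
    intro ε hε
    obtain ⟨δ, hδ, hzδ⟩ := Metric.uniformContinuous_iff.1 hzu ε hε
    refine ⟨δ, hδ, fun t t' htt => ?_⟩
    have hle : ∫⁻ s, (z (t - s) : ℝ≥0∞) ∂M ≤ ∫⁻ s, (z (t' - s) : ℝ≥0∞) ∂M + ε * C := by
      calc _ ≤ ∫⁻ s, ((z (t' - s) : ℝ≥0∞) +
              (Ioc (t - R - 1) (t - R - 1 + (2 * R + 1))).indicator (fun _ => (ε : ℝ≥0∞)) s) ∂M := by
            refine lintegral_mono fun s => ?_
            by_cases hs : s ∈ Ioc (t - R - 1) (t - R - 1 + (2 * R + 1))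
            · rw [indicator_of_mem hs]
              have := hzδ (a := t - s) (b := t' - s) (by simpa using htt)
              rw [NNReal.dist_eq] at this
              have h2 := (abs_lt.1 this).2
              rw [← ENNReal.coe_add, ENNReal.coe_le_coe, ← NNReal.coe_le_coe]
              push_cast
              linarith
            · rw [hR, ENNReal.coe_zero]
              · exact zero_le
              · by_contra! h
                rw [abs_le] at h
                exact hs ⟨by linarith, by linarith⟩
        _ ≤ _ := by
            rw [lintegral_add_left (by fun_prop), lintegral_indicator_const measurableSet_Ioc]
            gcongr
            exact hMC _
    have hfin : ∫⁻ s, (z (t' - s) : ℝ≥0∞) ∂M ≠ ∞ := ne_top_of_le_ne_top ENNReal.coe_ne_top (hB t')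
    have h3 := ENNReal.toReal_mono (ENNReal.add_ne_top.2 ⟨hfin, by finiteness⟩) hle
    rw [ENNReal.toReal_add hfin (by finiteness)] at h3
    simpa using h3
  refine Metric.uniformContinuous_iff.2 fun ε hε => ?_
  have hC1 : (0 : ℝ) < C + 1 := by positivity
  -- Dividing by `C + 1` rather than `C` also covers `C = 0`.
  obtain ⟨δ, hδ, h⟩ := hone (ε / (C + 1)).toNNReal (Real.toNNReal_pos.2 (by positivity))
  refine ⟨δ, hδ, fun t t' htt => ?_⟩
  have h1 := h t t' htt
  have h2 := h t' t (by rwa [dist_comm])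
  rw [Real.coe_toNNReal _ (by positivity)] at h1 h2
  have h3 : ε / (C + 1) * C < ε := by
    rw [div_mul_eq_mul_div, div_lt_iff₀ hC1]
    nlinarith
  rw [Real.dist_eq, abs_lt]
  constructor <;> linarith

end Convolution

/-! ### Blackwell's theorem for the parent points. -/

section Blackwell

variable {D F : Measure ℝ} [IsProbabilityMeasure D] [IsProbabilityMeasure F]

theorem measurable_lintegral_sub (M : Measure ℝ) [SFinite M] {f : ℝ → ℝ≥0∞} (hf : Measurable f) :
    Measurable fun t : ℝ => ∫⁻ s, f (t - s) ∂M :=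
  Measurable.lintegral_prod_right' (f := fun p : ℝ × ℝ => f (p.1 - p.2)) (by fun_prop)

theorem lintegral_sub_delayedRenewalMeasure {f : ℝ → ℝ≥0∞} (hf : Measurable f) (t : ℝ) :
    ∫⁻ s, f (t - s) ∂delayedRenewalMeasure D F = ∫⁻ s, f (t - s) ∂D +
      ∫⁻ x, ∫⁻ s, f (t - x - s) ∂delayedRenewalMeasure D F ∂F := by
  rw [lintegral_delayedRenewalMeasure (f := fun s => f (t - s)) (by fun_prop)]
  congr 1
  rw [lintegral_lintegral_swap (by fun_prop)]
  refine lintegral_congr fun x => lintegral_congr fun s => ?_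
  congr 1
  ring

/-- By associativity and commutativity of convolution, `H ∗ (f ∗ V) = f ∗ (H ∗ V)`, and `H ∗ V` is
the distribution function of `D`. -/
theorem lintegral_survival_mul (hD : D (Iio 0) = 0) (hF : F (Iio 0) = 0) (hpos : 0 < ∫ x, x ∂F)
    {f : ℝ → ℝ≥0∞} (hf : Measurable f) (t : ℝ) :
    ∫⁻ y, survival F y * ∫⁻ s, f (t - y - s) ∂delayedRenewalMeasure D F =
      ∫⁻ x, f x * D (Iic (t - x)) := by
  have hH := measurable_survival F
  calc _ = ∫⁻ y, ∫⁻ s, survival F y * f (t - y - s) ∂delayedRenewalMeasure D F := by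
        refine lintegral_congr fun y => ?_
        rw [lintegral_const_mul _ (by fun_prop)]
    _ = ∫⁻ s, ∫⁻ y, survival F y * f (t - y - s) ∂volume ∂delayedRenewalMeasure D F :=
        lintegral_lintegral_swap (by fun_prop)
    _ = ∫⁻ s, ∫⁻ x, survival F (t - x - s) * f x ∂volume ∂delayedRenewalMeasure D F := by
        refine lintegral_congr fun s => ?_
        -- Substitution `y = (t - s) - x`, under which Lebesgue measure is invariant.
        rw [← lintegral_sub_left_eq_self (fun y => survival F y * f (t - y - s)) (t - s)]
        refine lintegral_congr fun x => ?_
        congr 2 <;> ring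
    _ = ∫⁻ x, ∫⁻ s, survival F (t - x - s) * f x ∂delayedRenewalMeasure D F ∂volume :=
        lintegral_lintegral_swap (by fun_prop)
    _ = _ := by
        refine lintegral_congr fun x => ?_
        rw [lintegral_mul_const _ (by fun_prop), lintegral_survival_eq hD hF hpos, mul_comm]

/-- `u = z ∗ V` varies ever less over fixed distances, so averaging it against `H`, of total mass
`m`, amounts to multiplying it by `m`. The average is known exactly and tends to `∫ z`, hence no
compactness argument is needed to obtain the limit. -/
theorem tendsto_lintegral_delayedRenewalMeasure (hD : D (Iio 0) = 0) (hF : F (Iio 0) = 0)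
    (hint : Integrable (fun x => x) F) (hpos : 0 < ∫ x, x ∂F)
    (hna : ∀ h : ℝ, 0 < h → ¬ ∀ᵐ x ∂F, ∃ k : ℤ, x = k * h)
    {z : ℝ → ℝ≥0} (hz : Continuous z) (hzc : HasCompactSupport z) :
    Tendsto (fun t : ℝ => ∫⁻ s, (z (t - s) : ℝ≥0∞) ∂delayedRenewalMeasure D F) atTop
      (𝓝 (ENNReal.ofReal (∫ x, x ∂F)⁻¹ * ∫⁻ x, (z x : ℝ≥0∞))) := by
  set V := delayedRenewalMeasure D F with hV
  set m := ∫ x, x ∂F with hm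
  have hVu : UniformlyLocallyFinite V := uniformlyLocallyFinite_delayedRenewalMeasure hF hpos
  have hzm : Measurable fun x => (z x : ℝ≥0∞) := hz.measurable.coe_nnreal_ennreal
  set U : ℝ → ℝ≥0∞ := fun t => ∫⁻ s, (z (t - s) : ℝ≥0∞) ∂V with hU
  have hUm : Measurable U := measurable_lintegral_sub V hzm
  obtain ⟨B, hB⟩ := hVu.lintegral_sub_le hz hzc
  have hUfin : ∀ t, U t ≠ ∞ := fun t => ne_top_of_le_ne_top ENNReal.coe_ne_top (hB t)
  set u : ℝ → ℝ := fun t => (U t).toReal with hu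
  have huB : ∀ t, |u t| ≤ B := fun t => by
    rw [abs_of_nonneg ENNReal.toReal_nonneg]
    exact ENNReal.toReal_mono ENNReal.coe_ne_top (hB t)
  have huc : UniformContinuous u := hVu.uniformContinuous hz hzc
  have hr := tendsto_lintegral_sub_zero D hz hzc
  have hr' : Tendsto (fun t => (∫⁻ s, (z (t - s) : ℝ≥0∞) ∂D).toReal) atTop (𝓝 0) := by
    simpa [Function.comp_def] using (ENNReal.tendsto_toReal ENNReal.zero_ne_top).comp hr
  have hren : ∀ t, u t = (∫⁻ s, (z (t - s) : ℝ≥0∞) ∂D).toReal + ∫ x, u (t - x) ∂F := by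
    intro t
    have h1 := lintegral_sub_delayedRenewalMeasure (D := D) (F := F) hzm t
    have h2 : (∫⁻ s, (z (t - s) : ℝ≥0∞) ∂D) + ∫⁻ x, U (t - x) ∂F ≠ ∞ := h1 ▸ hUfin t
    simp only [hu]
    rw [integral_toReal (by fun_prop) (Eventually.of_forall fun x => (hUfin _).lt_top),
      ← ENNReal.toReal_add (ENNReal.add_ne_top.1 h2).1 (ENNReal.add_ne_top.1 h2).2]
    exact congrArg ENNReal.toReal h1
  have hdiff := tendsto_sub_of_nonarithmetic huB huc hr' hren hna
  set H : ℝ → ℝ := fun y => (survival F y).toReal with hH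
  have hHm : Measurable H := (measurable_survival F).ennreal_toReal
  have hSfin : ∀ y, survival F y < ∞ := fun y => (survival_le_one y).trans_lt ENNReal.one_lt_top
  have hHint : ∫ y, H y = m := by
    rw [integral_toReal (measurable_survival F).aemeasurable (Eventually.of_forall hSfin),
      lintegral_survival hF hint, ENNReal.toReal_ofReal hpos.le]
  have hHi : Integrable H := integrable_toReal_of_lintegral_ne_top
    (measurable_survival F).aemeasurable (by rw [lintegral_survival hF hint]; finiteness)
  have hzfin : ∫⁻ x, (z x : ℝ≥0∞) ≠ ∞ := by
    have := (NNReal.continuous_coe.comp hz).integrable_of_hasCompactSupport (μ := volume)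
      (hzc.comp_left (g := ((↑) : ℝ≥0 → ℝ)) rfl)
    have h2 := this.2
    simpa [HasFiniteIntegral, enorm_eq_nnnorm] using h2.ne
  have hlimz : Tendsto (fun t : ℝ => ∫⁻ x, (z x : ℝ≥0∞) * D (Iic (t - x))) atTop
      (𝓝 (∫⁻ x, (z x : ℝ≥0∞))) := by
    refine tendsto_lintegral_filter_of_dominated_convergence (fun x => (z x : ℝ≥0∞))
      (Eventually.of_forall fun t => ?_)
      (Eventually.of_forall fun t => Eventually.of_forall fun x =>
        mul_le_of_le_one_right' prob_le_one)
      hzfin (Eventually.of_forall fun x => ?_)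
    · refine hzm.mul (Measurable.comp (g := fun y => D (Iic y)) ?_ (by fun_prop))
      exact Monotone.measurable fun _ _ hab => measure_mono (Iic_subset_Iic.2 hab)
    · have h1 : Tendsto (fun t : ℝ => t - x) atTop atTop :=
        tendsto_atTop_add_const_right _ _ tendsto_id
      have h2 := (tendsto_measure_Iic_atTop D).comp h1
      rw [measure_univ] at h2
      simpa using ENNReal.Tendsto.const_mul h2 (Or.inr (ENNReal.coe_ne_top (r := z x)))
  have hprod : ∀ t, ∫ y, H y * u (t - y) = (∫⁻ x, (z x : ℝ≥0∞) * D (Iic (t - x))).toReal := by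
    intro t
    rw [← lintegral_survival_mul hD hF hpos hzm, ← integral_toReal]
    · simp [hH, hu, hU, hV]
    · exact ((measurable_survival F).mul (hUm.comp (by fun_prop))).aemeasurable
    · exact Eventually.of_forall fun y => ENNReal.mul_lt_top (hSfin y) (hUfin (t - y)).lt_top
  have hlim1 : Tendsto (fun t => ∫ y, H y * u (t - y)) atTop
      (𝓝 (∫⁻ x, (z x : ℝ≥0∞)).toReal) := by
    simp only [hprod]
    exact (ENNReal.tendsto_toReal hzfin).comp hlimz
  have huint : ∀ t, Integrable fun y => H y * u (t - y) := fun t =>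
    hHi.mul_bdd (c := B) (huc.continuous.comp (by fun_prop)).aestronglyMeasurable
      (Eventually.of_forall fun y => huB _)
  have hlim2 : Tendsto (fun t => ∫ y, H y * (u t - u (t - y))) atTop (𝓝 (∫ _ : ℝ, (0 : ℝ))) := by
    refine tendsto_integral_filter_of_dominated_convergence (fun y => H y * (2 * B))
      (Eventually.of_forall fun t => ?_)
      (Eventually.of_forall fun t => Eventually.of_forall fun y => ?_) (hHi.mul_const _)
      (Eventually.of_forall fun y => by simpa using (hdiff y).const_mul (H y))
    · exact (hHm.mul (measurable_const.sub
        (huc.continuous.measurable.comp (by fun_prop)))).aestronglyMeasurable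
    · rw [norm_mul, Real.norm_of_nonneg ENNReal.toReal_nonneg]
      refine mul_le_mul_of_nonneg_left ((abs_sub _ _).trans ?_) ENNReal.toReal_nonneg
      linarith [huB t, huB (t - y)]
  -- Uses `∫ H = m`. The first term tends to `0` because the increments do, the second to `∫ z`.
  have hmu : ∀ t, m * u t = (∫ y, H y * (u t - u (t - y))) + ∫ y, H y * u (t - y) := by
    intro t
    simp only [mul_sub]
    rw [integral_sub (hHi.mul_const _) (huint t), integral_mul_const, hHint]
    ring
  have hlim3 : Tendsto u atTop (𝓝 (m⁻¹ * (∫⁻ x, (z x : ℝ≥0∞)).toReal)) := by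
    have h1 := (hlim2.add hlim1).const_mul m⁻¹
    simp only [← hmu, integral_zero, zero_add] at h1
    refine h1.congr fun t => ?_
    rw [← mul_assoc, inv_mul_cancel₀ hpos.ne', one_mul]
  have hlim4 := ENNReal.tendsto_ofReal hlim3
  rw [ENNReal.ofReal_mul (inv_nonneg.2 hpos.le), ENNReal.ofReal_toReal hzfin] at hlim4
  exact hlim4.congr fun t => ENNReal.ofReal_toReal (hUfin t)

end Blackwell

/-! ### Mean measure of a single cluster. -/

section Offspring

/-- The points of a cluster with mark `w`, seen from the preceding parent point. -/
noncomputable def offspring (w : ℕ × (ℕ → ℝ) × ℝ≥0) : Measure ℝ :=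
  ∑ j ∈ Finset.range w.1, Measure.dirac ((w.2.2 : ℝ) + w.2.1 j)

theorem lintegral_offspring {f : ℝ → ℝ≥0∞} (hf : Measurable f) (w : ℕ × (ℕ → ℝ) × ℝ≥0) :
    ∫⁻ x, f x ∂offspring w = ∑ j ∈ Finset.range w.1, f ((w.2.2 : ℝ) + w.2.1 j) := by
  rw [offspring, lintegral_finsetSum_measure]
  exact Finset.sum_congr rfl fun j _ => lintegral_dirac' _ hf

theorem measurable_lintegral_offspring {f : ℝ → ℝ≥0∞} (hf : Measurable f) :
    Measurable fun p : ℝ × ℕ × (ℕ → ℝ) × ℝ≥0 => ∫⁻ x, f (p.1 + x) ∂offspring p.2 := by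
  have h : Measurable fun q : ℕ × ℝ × (ℕ → ℝ) × ℝ≥0 =>
      ∑ j ∈ Finset.range q.1, f (q.2.1 + ((q.2.2.2 : ℝ) + q.2.2.1 j)) :=
    measurable_from_prod_countable_right fun n =>
      Finset.measurable_fun_sum (Finset.range n) fun j _ =>
        hf.comp (g := f) (f := fun y : ℝ × (ℕ → ℝ) × ℝ≥0 => y.1 + ((y.2.2 : ℝ) + y.2.1 j))
          (by fun_prop)
  have h2 : ∀ p : ℝ × ℕ × (ℕ → ℝ) × ℝ≥0, ∫⁻ x, f (p.1 + x) ∂offspring p.2 =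
      ∑ j ∈ Finset.range p.2.1, f (p.1 + ((p.2.2.2 : ℝ) + p.2.2.1 j)) := fun p =>
    lintegral_offspring (f := fun x => f (p.1 + x)) (by fun_prop) p.2
  simp only [h2]
  exact h.comp (f := fun p : ℝ × ℕ × (ℕ → ℝ) × ℝ≥0 => (p.2.1, p.1, p.2.2)) (by fun_prop)

theorem measurable_offspring : Measurable offspring := by
  refine Measure.measurable_of_measurable_coe _ fun B hB => ?_
  have hf : Measurable (B.indicator (1 : ℝ → ℝ≥0∞)) := measurable_one.indicator hB
  have h := (measurable_lintegral_offspring hf).comp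
    (f := fun w : ℕ × (ℕ → ℝ) × ℝ≥0 => ((0 : ℝ), w)) (by fun_prop)
  simpa [Function.comp_def, lintegral_indicator_one hB] using h

variable {Ω : Type*} [MeasurableSpace Ω]

/-- The mean measure of the offspring of a random mark. -/
noncomputable def meanOffspring (P : Measure Ω) (W : Ω → ℕ × (ℕ → ℝ) × ℝ≥0) : Measure ℝ :=
  (P.map W).bind offspring

theorem lintegral_meanOffspring {P : Measure Ω} {W : Ω → ℕ × (ℕ → ℝ) × ℝ≥0} (hW : Measurable W)
    {f : ℝ → ℝ≥0∞} (hf : Measurable f) :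
    ∫⁻ x, f x ∂meanOffspring P W = ∫⁻ ω, ∫⁻ x, f x ∂offspring (W ω) ∂P := by
  rw [meanOffspring, Measure.lintegral_bind measurable_offspring.aemeasurable hf.aemeasurable,
    lintegral_map _ hW]
  simpa [Function.comp_def] using (measurable_lintegral_offspring hf).comp
    (f := fun w : ℕ × (ℕ → ℝ) × ℝ≥0 => ((0 : ℝ), w)) (by fun_prop)

theorem meanOffspring_univ {P : Measure Ω} {W : Ω → ℕ × (ℕ → ℝ) × ℝ≥0} (hW : Measurable W)
    (hint : Integrable (fun ω => ((W ω).1 : ℝ)) P) :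
    meanOffspring P W univ = ENNReal.ofReal (∫ ω, ((W ω).1 : ℝ) ∂P) := by
  rw [ofReal_integral_eq_lintegral_ofReal hint (Eventually.of_forall fun ω => Nat.cast_nonneg _),
    ← lintegral_one, lintegral_meanOffspring hW measurable_const]
  exact lintegral_congr fun ω => by rw [lintegral_offspring measurable_const]; simp

theorem isFiniteMeasure_meanOffspring {P : Measure Ω} {W : Ω → ℕ × (ℕ → ℝ) × ℝ≥0}
    (hW : Measurable W) (hint : Integrable (fun ω => ((W ω).1 : ℝ)) P) :
    IsFiniteMeasure (meanOffspring P W) :=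
  ⟨by rw [meanOffspring_univ hW hint]; exact ENNReal.ofReal_lt_top⟩

end Offspring

/-! ### Decomposition of the cluster renewal measure. -/

section Cluster

/-- The index shift pairs `T'_i` with the mark of index `i + 1`, of which it is independent; the
increment `X'_{i+1}` is absorbed into the offspring. The cluster of index `0` has no preceding
parent and stands apart. -/
theorem lintegral_clusterProcess {Ω : Type*} {L : ℕ → Ω → ℕ} {τ : ℕ → ℕ → Ω → ℝ} {X : ℕ → Ω → ℝ≥0}
    {f : ℝ → ℝ≥0∞} (hf : Measurable f) (ω : Ω) :
    ∫⁻ x, f x ∂(clusterProcess L τ X ω) = ∫⁻ x, f x ∂offspring (mark L τ X 0 ω) +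
      ∑' i, ∫⁻ x, f (arrival X i ω + x) ∂offspring (mark L τ X (i + 1) ω) := by
  rw [clusterProcess, lintegral_sum_measure, tsum_eq_zero_add' ENNReal.summable]
  congr 1
  · rw [lintegral_finsetSum_measure, lintegral_offspring hf]
    refine Finset.sum_congr rfl fun j _ => ?_
    rw [lintegral_dirac' _ hf]
    simp [mark, arrival]
  · refine tsum_congr fun i => ?_
    rw [lintegral_finsetSum_measure,
      lintegral_offspring (f := fun x => f (arrival X i ω + x)) (by fun_prop)]
    refine Finset.sum_congr rfl fun j _ => ?_
    rw [lintegral_dirac' _ hf]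
    simp [mark, arrival, Finset.sum_range_succ _ (i + 1), add_assoc]

variable {Ω : Type*} [MeasurableSpace Ω] {P : Measure Ω}
  {L : ℕ → Ω → ℕ} {τ : ℕ → ℕ → Ω → ℝ} {X : ℕ → Ω → ℝ≥0}

namespace IsRenewalClusterProcess

theorem measurable_mark (hξ : IsRenewalClusterProcess P L τ X) (i : ℕ) :
    Measurable (mark L τ X i) :=
  (hξ.measurable_size i).prodMk
    ((measurable_pi_lambda _ fun j => hξ.measurable_pos i j).prodMk (hξ.measurable_incr i))

theorem measurable_arrival (hξ : IsRenewalClusterProcess P L τ X) (i : ℕ) :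
    Measurable (arrival X i) :=
  Finset.measurable_fun_sum _ fun k _ => (hξ.measurable_incr k).coe_nnreal_real

end IsRenewalClusterProcess

/-- Each of the `L'_1` points satisfies `|t - (X'_1 + T'_{1j})| ≤ |t| + X'_1 + R'_1`, so the moments
of `L'_1`, `L'_1 X'_1` and `L'_1 R'_1` suffice. The integrand matches the linear bound on the growth
of `V`. -/
theorem lintegral_meanOffspring_abs_lt_top (hξ : IsRenewalClusterProcess P L τ X)
    (hmom : FiniteMoments P L τ X) (t : ℝ) :
    ∫⁻ x, ENNReal.ofReal (|t - x| + 2) ∂meanOffspring P (mark L τ X 1) < ∞ := by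
  rw [lintegral_meanOffspring (hξ.measurable_mark 1) (by fun_prop)]
  refine lt_of_le_of_lt (lintegral_mono fun ω => ?_)
    (((hmom.size_one.const_mul (|t| + 2)).add hmom.size_incr).add
      hmom.size_radius).lintegral_lt_top
  rw [lintegral_offspring (by fun_prop), ← ENNReal.ofReal_sum_of_nonneg fun j _ => by positivity]
  refine ENNReal.ofReal_le_ofReal ?_
  have hle : ∀ j ∈ Finset.range (L 1 ω),
      |t - ((X 1 ω : ℝ) + τ 1 j ω)| + 2 ≤ |t| + 2 + X 1 ω + radius L τ 1 ω := by
    intro j hj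
    have hr : |τ 1 j ω| ≤ radius L τ 1 ω := by
      have := Finset.le_sup (f := fun j => ‖τ 1 j ω‖₊) hj
      exact_mod_cast this
    have h1 := abs_sub t ((X 1 ω : ℝ) + τ 1 j ω)
    have h2 := abs_add_le (X 1 ω : ℝ) (τ 1 j ω)
    rw [NNReal.abs_eq] at h2
    linarith
  refine (Finset.sum_le_sum hle).trans (le_of_eq ?_)
  simp only [Finset.sum_const, Finset.card_range, nsmul_eq_mul, Pi.add_apply]
  ring

namespace IsRenewalClusterProcess

theorem indepFun_arrival_mark (hξ : IsRenewalClusterProcess P L τ X) (i : ℕ) :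
    IndepFun (arrival X i) (mark L τ X (i + 1)) P := by
  have h := hξ.indep.indepFun_finset (Finset.range (i + 1)) {i + 1} (by simp) hξ.measurable_mark
  have h2 := h.comp
    (φ := fun v : Finset.range (i + 1) → ℕ × (ℕ → ℝ) × ℝ≥0 => ∑ k, ((v k).2.2 : ℝ))
    (ψ := fun v : ({i + 1} : Finset ℕ) → ℕ × (ℕ → ℝ) × ℝ≥0 =>
      v ⟨i + 1, Finset.mem_singleton_self _⟩) (by fun_prop)
    (measurable_pi_apply (X := fun _ : ({i + 1} : Finset ℕ) => ℕ × (ℕ → ℝ) × ℝ≥0) _)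
  convert! h2 using 1
  funext ω
  simp only [arrival, mark, Function.comp_apply]
  exact (Finset.sum_coe_sort (Finset.range (i + 1)) fun k => (X k ω : ℝ)).symm

variable [IsProbabilityMeasure P]

theorem map_arrival (hξ : IsRenewalClusterProcess P L τ X) (i : ℕ) :
    P.map (arrival X i) =
      pointLaw (P.map fun ω => (X 0 ω : ℝ)) (P.map fun ω => (X 1 ω : ℝ)) i := by
  have hp : Measurable fun w : ℕ × (ℕ → ℝ) × ℝ≥0 => (w.2.2 : ℝ) := by fun_prop
  induction i with
  | zero =>
    simp only [pointLaw]
    congr 1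
    funext ω
    simp [arrival]
  | succ i ih =>
    have h1 : arrival X (i + 1) = arrival X i + fun ω => (X (i + 1) ω : ℝ) := by
      funext ω
      simp [arrival, Finset.sum_range_succ _ (i + 1)]
    have h2 : IndepFun (arrival X i) (fun ω => (X (i + 1) ω : ℝ)) P :=
      (hξ.indepFun_arrival_mark i).comp measurable_id hp
    rw [h1, h2.map_add_eq_map_conv_map₀ (hξ.measurable_arrival i).aemeasurable
      (hξ.measurable_incr (i + 1)).coe_nnreal_real.aemeasurable, ih, pointLaw]
    congr 1
    exact ((hξ.identDistrib (i + 1) (by omega)).comp hp).map_eq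

theorem lintegral_cluster_succ (hξ : IsRenewalClusterProcess P L τ X) {f : ℝ → ℝ≥0∞}
    (hf : Measurable f) (i : ℕ) :
    ∫⁻ ω, ∫⁻ x, f (arrival X i ω + x) ∂offspring (mark L τ X (i + 1) ω) ∂P =
      ∫⁻ s, ∫⁻ x, f (s + x) ∂meanOffspring P (mark L τ X 1) ∂P.map (arrival X i) := by
  have hm := measurable_lintegral_offspring hf
  have hprod := (indepFun_iff_map_prod_eq_prod_map_map (hξ.measurable_arrival i).aemeasurable
    (hξ.measurable_mark (i + 1)).aemeasurable).1 (hξ.indepFun_arrival_mark i)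
  have hW : IsProbabilityMeasure (P.map (mark L τ X (i + 1))) :=
    Measure.isProbabilityMeasure_map (hξ.measurable_mark _).aemeasurable
  calc _ = ∫⁻ p, ∫⁻ x, f (p.1 + x) ∂offspring p.2
          ∂P.map (fun ω => (arrival X i ω, mark L τ X (i + 1) ω)) := by
        rw [lintegral_map hm ((hξ.measurable_arrival i).prodMk (hξ.measurable_mark (i + 1)))]
    _ = ∫⁻ s, ∫⁻ w, ∫⁻ x, f (s + x) ∂offspring w ∂P.map (mark L τ X (i + 1))
          ∂P.map (arrival X i) := by
        rw [hprod, lintegral_prod _ hm.aemeasurable]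
    _ = _ := by
        refine lintegral_congr fun s => ?_
        rw [(hξ.identDistrib (i + 1) (by omega)).map_eq, meanOffspring, Measure.lintegral_bind
          measurable_offspring.aemeasurable (Measurable.aemeasurable (by fun_prop))]

/-- Independence of `T'_i` and the mark of index `i + 1` turns each summand into the convolution of
the law of `T'_i` with a mean offspring measure that does not depend on `i`. Summing the laws of the
`T'_i` yields the parent renewal measure. -/
theorem renewalMeasure_eq (hξ : IsRenewalClusterProcess P L τ X)
    [SFinite (meanOffspring P (mark L τ X 1))] :
    renewalMeasure P L τ X = meanOffspring P (mark L τ X 0) +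
      delayedRenewalMeasure (P.map fun ω => (X 0 ω : ℝ)) (P.map fun ω => (X 1 ω : ℝ)) ∗
        meanOffspring P (mark L τ X 1) := by
  refine Measure.ext_of_lintegral _ fun f hf => ?_
  have hm0 : Measurable fun ω => ∫⁻ x, f x ∂offspring (mark L τ X 0 ω) := by
    simpa [Function.comp_def] using (measurable_lintegral_offspring hf).comp
      (f := fun ω => ((0 : ℝ), mark L τ X 0 ω)) (measurable_const.prodMk (hξ.measurable_mark 0))
  have hm : ∀ i, Measurable fun ω =>
      ∫⁻ x, f (arrival X i ω + x) ∂offspring (mark L τ X (i + 1) ω) := fun i =>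
    (measurable_lintegral_offspring hf).comp
      (f := fun ω => (arrival X i ω, mark L τ X (i + 1) ω))
      ((hξ.measurable_arrival i).prodMk (hξ.measurable_mark (i + 1)))
  have hbind : ∫⁻ x, f x ∂renewalMeasure P L τ X =
      ∫⁻ ω, ∫⁻ x, f x ∂(clusterProcess L τ X ω) ∂P :=
    Measure.lintegral_bind (measurable_clusterProcess hξ.measurable_size hξ.measurable_pos
      hξ.measurable_incr).aemeasurable hf.aemeasurable
  have hright : ∫⁻ s, ∫⁻ x, f (s + x) ∂meanOffspring P (mark L τ X 1)
      ∂delayedRenewalMeasure (P.map fun ω => (X 0 ω : ℝ)) (P.map fun ω => (X 1 ω : ℝ)) =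
      ∑' i, ∫⁻ ω, ∫⁻ x, f (arrival X i ω + x) ∂offspring (mark L τ X (i + 1) ω) ∂P := by
    rw [delayedRenewalMeasure, lintegral_sum_measure]
    refine tsum_congr fun i => ?_
    rw [hξ.lintegral_cluster_succ hf, hξ.map_arrival]
  rw [hbind, lintegral_congr fun ω => lintegral_clusterProcess hf ω, lintegral_add_left hm0,
    lintegral_tsum fun i => (hm i).aemeasurable, lintegral_add_measure, Measure.lintegral_conv hf,
    lintegral_meanOffspring (hξ.measurable_mark 0) hf, hright]

end IsRenewalClusterProcess

end Cluster

/-! ### Transfer from the parent renewal measure to the cluster renewal measure. -/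

section ConvolvedRenewal

variable {D F M₀ N : Measure ℝ} [IsProbabilityMeasure D] [IsProbabilityMeasure F]
  [IsFiniteMeasure M₀] [IsFiniteMeasure N]

theorem uniformlyLocallyFinite_add_conv (hF : F (Iio 0) = 0) (hpos : 0 < ∫ x, x ∂F) :
    UniformlyLocallyFinite (M₀ + delayedRenewalMeasure D F ∗ N) := by
  intro h
  obtain ⟨C, hC, hVC⟩ := uniformlyLocallyFinite_delayedRenewalMeasure (D := D) hF hpos h
  refine ⟨M₀ univ + C * N univ, by finiteness, fun a => ?_⟩
  rw [Measure.add_apply, Measure.conv_comm, conv_apply_eq_lintegral _ _ measurableSet_Ioc]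
  gcongr
  · exact subset_univ _
  · calc _ ≤ ∫⁻ _, C ∂N := by
          refine lintegral_mono fun x => ?_
          simp only [preimage_const_add_Ioc]
          convert! hVC (a - x) using 3
          ring
      _ = _ := lintegral_const C

/-- The finite measure `M₀` contributes nothing in the limit. In the other term Blackwell's limit is
taken under the integral over `N`: the functions are uniformly bounded and `N` is finite, which
gives the factor `N univ`. -/
theorem tendsto_lintegral_add_conv (hD : D (Iio 0) = 0) (hF : F (Iio 0) = 0)
    (hint : Integrable (fun x => x) F) (hpos : 0 < ∫ x, x ∂F)
    (hna : ∀ h : ℝ, 0 < h → ¬ ∀ᵐ x ∂F, ∃ k : ℤ, x = k * h)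
    {z : ℝ → ℝ≥0} (hz : Continuous z) (hzc : HasCompactSupport z) :
    Tendsto (fun t : ℝ => ∫⁻ y, (z (t - y) : ℝ≥0∞) ∂(M₀ + delayedRenewalMeasure D F ∗ N)) atTop
      (𝓝 (N univ * ENNReal.ofReal (∫ x, x ∂F)⁻¹ * ∫⁻ x, (z x : ℝ≥0∞))) := by
  have hzm : Measurable fun x => (z x : ℝ≥0∞) := hz.measurable.coe_nnreal_ennreal
  set U : ℝ → ℝ≥0∞ := fun t => ∫⁻ s, (z (t - s) : ℝ≥0∞) ∂delayedRenewalMeasure D F with hU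
  have hUm : Measurable U := measurable_lintegral_sub _ hzm
  have heq : ∀ t, ∫⁻ y, (z (t - y) : ℝ≥0∞) ∂(M₀ + delayedRenewalMeasure D F ∗ N) =
      ∫⁻ y, (z (t - y) : ℝ≥0∞) ∂M₀ + ∫⁻ x, U (t - x) ∂N := by
    intro t
    rw [lintegral_add_measure, Measure.conv_comm, Measure.lintegral_conv (by fun_prop)]
    simp only [hU, sub_sub]
  obtain ⟨B, hB⟩ := UniformlyLocallyFinite.lintegral_sub_le
    (uniformlyLocallyFinite_delayedRenewalMeasure (D := D) hF hpos) hz hzc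
  have hlim := tendsto_lintegral_delayedRenewalMeasure hD hF hint hpos hna hz hzc
  have hconv : Tendsto (fun t => ∫⁻ x, U (t - x) ∂N) atTop
      (𝓝 (∫⁻ _ : ℝ, ENNReal.ofReal (∫ x, x ∂F)⁻¹ * (∫⁻ x, (z x : ℝ≥0∞)) ∂N)) :=
    tendsto_lintegral_filter_of_dominated_convergence (fun _ => (B : ℝ≥0∞))
      (Eventually.of_forall fun t => hUm.comp (measurable_const_sub t))
      (Eventually.of_forall fun t => Eventually.of_forall fun x => hB _)
      (by rw [lintegral_const]; exact ENNReal.mul_ne_top ENNReal.coe_ne_top (measure_ne_top N _))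
      (Eventually.of_forall fun x => hlim.comp (tendsto_atTop_add_const_right _ _ tendsto_id))
  have h := (tendsto_lintegral_sub_zero M₀ hz hzc).add hconv
  rw [lintegral_const, zero_add] at h
  simp only [heq]
  convert! h using 2
  ring

theorem add_conv_Iic_lt_top (hD : D (Iio 0) = 0) (hF : F (Iio 0) = 0) (hpos : 0 < ∫ x, x ∂F)
    (t : ℝ) (hN : ∫⁻ x, ENNReal.ofReal (|t - x| + 2) ∂N < ∞) :
    (M₀ + delayedRenewalMeasure D F ∗ N) (Iic t) < ∞ := by
  obtain ⟨C, hC, hVC⟩ := exists_delayedRenewalMeasure_Iic_le hD hF hpos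
  rw [Measure.add_apply, Measure.conv_comm, conv_apply_eq_lintegral _ _ measurableSet_Iic]
  refine ENNReal.add_lt_top.2 ⟨measure_lt_top _ _, ?_⟩
  calc _ ≤ ∫⁻ x, C * ENNReal.ofReal (|t - x| + 2) ∂N := by
        refine lintegral_mono fun x => ?_
        simp only [preimage_const_add_Iic]
        exact hVC _
    _ < ∞ := by
        rw [lintegral_const_mul _ (by fun_prop)]
        exact ENNReal.mul_lt_top hC.lt_top hN

end ConvolvedRenewal

end RenewalCluster

/-! ### The key renewal theorem for cluster processes. -/

theorem corollary5 {Ω : Type*} [MeasurableSpace Ω] (P : Measure Ω) [IsProbabilityMeasure P]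
    (L : ℕ → Ω → ℕ) (τ : ℕ → ℕ → Ω → ℝ) (X : ℕ → Ω → ℝ≥0)
    (hξ : RenewalCluster.IsRenewalClusterProcess P L τ X)
    (hmom : RenewalCluster.FiniteMoments P L τ X)
    (g : ℝ≥0 → ℝ≥0) (hg : RenewalCluster.DirectlyRiemannIntegrable g) :
    (∀ t : ℝ, RenewalCluster.renewalFunction P L τ X t < ∞) ∧
    (∫⁻ y in Ici (0 : ℝ), (g y.toNNReal : ℝ≥0∞)) < ∞ ∧
    (∀ t : ℝ, ∫⁻ y in Icc 0 t, (g (t - y).toNNReal : ℝ≥0∞)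
        ∂(RenewalCluster.renewalMeasure P L τ X) < ∞) ∧
    Tendsto (fun t : ℝ => ∫⁻ y in Icc 0 t, (g (t - y).toNNReal : ℝ≥0∞)
        ∂(RenewalCluster.renewalMeasure P L τ X)) atTop
      (𝓝 (ENNReal.ofReal ((∫ ω, (L 1 ω : ℝ) ∂P) / ∫ ω, (X 1 ω : ℝ) ∂P) *
        ∫⁻ y in Ici (0 : ℝ), (g y.toNNReal : ℝ≥0∞))) ∧
    Tendsto (fun t : ℝ => ∫⁻ y in Ioc 0 t, (g (t - y).toNNReal : ℝ≥0∞)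
        ∂(RenewalCluster.renewalMeasure P L τ X)) atTop
      (𝓝 (ENNReal.ofReal ((∫ ω, (L 1 ω : ℝ) ∂P) / ∫ ω, (X 1 ω : ℝ) ∂P) *
        ∫⁻ y in Ici (0 : ℝ), (g y.toNNReal : ℝ≥0∞))) := by
  have hX1 : Measurable fun ω => (X 1 ω : ℝ) := (hξ.measurable_incr 1).coe_nnreal_real
  have hX0 : Measurable fun ω => (X 0 ω : ℝ) := (hξ.measurable_incr 0).coe_nnreal_real
  set D := P.map fun ω => (X 0 ω : ℝ) with hD
  set F := P.map fun ω => (X 1 ω : ℝ) with hF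
  have : IsProbabilityMeasure D := Measure.isProbabilityMeasure_map hX0.aemeasurable
  have : IsProbabilityMeasure F := Measure.isProbabilityMeasure_map hX1.aemeasurable
  have hD0 : D (Iio 0) = 0 := by
    rw [hD, Measure.map_apply hX0 measurableSet_Iio]
    simp [preimage, not_lt.2]
  have hF0 : F (Iio 0) = 0 := by
    rw [hF, Measure.map_apply hX1 measurableSet_Iio]
    simp [preimage, not_lt.2]
  have hmean : ∫ x, x ∂F = ∫ ω, (X 1 ω : ℝ) ∂P :=
    integral_map hX1.aemeasurable aestronglyMeasurable_id
  have hint : Integrable (fun x => x) F :=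
    (integrable_map_measure aestronglyMeasurable_id hX1.aemeasurable).2 hξ.integrable_incr
  have hpos : 0 < ∫ x, x ∂F := hmean ▸ hξ.mean_pos
  have hna : ∀ h : ℝ, 0 < h → ¬ ∀ᵐ x ∂F, ∃ k : ℤ, x = k * h := fun h hh hae =>
    hξ.nonarithmetic h hh (ae_of_ae_map hX1.aemeasurable hae)
  have : IsFiniteMeasure (RenewalCluster.meanOffspring P (RenewalCluster.mark L τ X 0)) :=
    RenewalCluster.isFiniteMeasure_meanOffspring (hξ.measurable_mark 0) hmom.size_zero
  have : IsFiniteMeasure (RenewalCluster.meanOffspring P (RenewalCluster.mark L τ X 1)) :=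
    RenewalCluster.isFiniteMeasure_meanOffspring (hξ.measurable_mark 1) hmom.size_one
  have hM := hξ.renewalMeasure_eq
  rw [← hD, ← hF] at hM
  have hulf : RenewalCluster.UniformlyLocallyFinite (RenewalCluster.renewalMeasure P L τ X) :=
    hM ▸ RenewalCluster.uniformlyLocallyFinite_add_conv hF0 hpos
  -- The mean offspring measure has total mass `E L'_1`, and Blackwell's theorem supplies the factor
  -- `1 / μ`.
  have hc : RenewalCluster.meanOffspring P (RenewalCluster.mark L τ X 1) univ *
      ENNReal.ofReal (∫ x, x ∂F)⁻¹ =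
        ENNReal.ofReal ((∫ ω, (L 1 ω : ℝ) ∂P) / ∫ ω, (X 1 ω : ℝ) ∂P) := by
    rw [RenewalCluster.meanOffspring_univ (hξ.measurable_mark 1) hmom.size_one, hmean,
      ← ENNReal.ofReal_mul (integral_nonneg fun ω => Nat.cast_nonneg _), div_eq_mul_inv]
    rfl
  have hvague : ∀ z : ℝ → ℝ≥0, Continuous z → HasCompactSupport z →
      Tendsto (fun t : ℝ => ∫⁻ y, (z (t - y) : ℝ≥0∞)
        ∂(RenewalCluster.renewalMeasure P L τ X)) atTop
        (𝓝 (ENNReal.ofReal ((∫ ω, (L 1 ω : ℝ) ∂P) / ∫ ω, (X 1 ω : ℝ) ∂P) *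
          ∫⁻ x, (z x : ℝ≥0∞))) := fun z hz hzc => by
    rw [← hc, hM]
    exact RenewalCluster.tendsto_lintegral_add_conv hD0 hF0 hint hpos hna hz hzc
  refine ⟨fun t => ?_, hg.lintegral_lt_top, hg.lintegral_Icc_lt_top hulf,
    hg.tendsto_lintegral_of_vague ENNReal.ofReal_ne_top hulf hvague (fun t => measurableSet_Icc)
      (fun t => Ioc_subset_Icc_self) (fun t => Subset.rfl),
    hg.tendsto_lintegral_of_vague ENNReal.ofReal_ne_top hulf hvague (fun t => measurableSet_Ioc)
      (fun t => Subset.rfl) (fun t => Ioc_subset_Icc_self)⟩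
  rw [← RenewalCluster.renewalMeasure_Iic hξ.measurable_size hξ.measurable_pos hξ.measurable_incr,
    hM]
  exact RenewalCluster.add_conv_Iic_lt_top hD0 hF0 hpos t
    (RenewalCluster.lintegral_meanOffspring_abs_lt_top hξ hmom t)
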